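/- Let $\Bbbk$ be a field of characteristic $0$ (for instance $\mathbb C$) and $n\ge 0$. An exp-polynomial function in $r$ variables is an element of the subalgebra of functions $\mathbb Z^r\to\Bbbk$ generated by $n_j$ and $a^{n_j}$ ($a\in\Bbbk\setminus\{0\}$, $1\le j\le r$). Let $G=\bigoplus_{\alpha\in\mathbb Z^n}G_\alpha$ be a $\mathbb Z^n$-graded Lie algebra over $\Bbbk$ that is exp-polynomial: it has a spanning set $\{g_k(\alpha)\mid k\in K,\ \alpha\in\mathbb Z^n\}$ with $g_k(\alpha)\in G_\alpha$, and exp-polynomial functions $f_{k,r}^s$ in $2n$ variables ($k,r,s\in K$), where for all $k,r$ only finitely many $f_{k,r}^s$ are nonzero, such that $$[g_k(\alpha),g_r(\beta)]=\sum_{s\in K}f_{k,r}^s(\alpha,\beta)\,g_s(\alpha+\beta)\qquad(k,r\in K,\ \alpha,\beta\in\mathbb Z^n).$$ Assume that $G$ is $\mathbb Z^n$-extragraded: $G$ has a second grading $G=\bigoplus_{i\in\mathbb Z}G^{(i)}$ as a Lie algebra, and $K$ is a disjoint union of finite subsets $K_i$ ($i\in\mathbb Z$) such that the $g_k(\alpha)$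 with $k\in K_i$, $\alpha\in\mathbb Z^n$ lie in $G^{(i)}$ and span it. Put $G^{+}=\bigoplus_{i\ge 1}G^{(i)}$. Let $V$ be a finite-dimensional exp-polynomial $G^{(0)}$-module, that is, a $G^{(0)}$-module with a finite basis $\{v_j\}_{j\in J}$ and exp-polynomial functions $h_{k,j}^s$ in $n$ variables ($k\in K_0$; $j,s\in J$) such that $g_k(\alpha)v_j=\sum_{s\in J}h_{k,j}^s(\alpha)v_s$ for all $k\in K_0$, $\alpha\in\mathbb Z^n$, $j\in J$. Let $G^+$ act on $V$ by zero, and let $\widetilde M(V)=U(G)\otimes_{U(G^{(0)}+G^+)}V$ be the induced $G$-module, $\mathbb Z$-graded by the grading of $U(G)$ induced from $G=\bigoplus_i G^{(i)}$, with $V$ in degree $0$. Let $\widetilde M^{\mathrm{rad}}$ be the largest $\mathbb Z$-graded $G$-submodule of $\widetilde M(V)$ that intersects $V$ trivially (the sum of all such submodules), and let $M(V)=\widetilde M(V)/\widetilde M^{\mathrm{rad}}$, with $M(V)^{(i)}$ the image of $\widetilde M(V)^{(i)}$. **Theorem.** The subspaces $M(V)^{(i)}$, $i\in\mathbb Z$,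 make $M(V)$ a $\mathbb Z$-graded $G$-module with finite-dimensional homogeneous spaces: $M(V)=\bigoplus_{i\in\mathbb Z}M(V)^{(i)}$, $G^{(i)}M(V)^{(j)}\subseteq M(V)^{(i+j)}$ for all $i,j\in\mathbb Z$, and $\dim M(V)^{(i)}<\infty$ for every $i\in\mathbb Z$. -/

import Mathlib

open scoped TensorProduct

/-- The algebra of exp-polynomial functions `ℤ^σ → 𝕜` in the variables `n_j`, `j ∈ σ`: the
subalgebra of all functions generated by the functions `n_j` and `a ^ n_j`, `a ∈ 𝕜 \ {0}`. -/
def expPolynomial (𝕜 : Type*) [Field 𝕜] (σ : Type*) : Subalgebra 𝕜 ((σ → ℤ) → 𝕜) :=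
  Algebra.adjoin 𝕜
    ({f | ∃ j : σ, f = fun n => ((n j : ℤ) : 𝕜)} ∪
      {f | ∃ (j : σ) (a : 𝕜), a ≠ 0 ∧ f = fun n => a ^ (n j)})

/-- A grading of the Lie algebra `G` by the additive group `ι`: a direct sum decomposition into
subspaces `G_i` with `[G_i, G_j] ⊆ G_{i+j}`. -/
structure LieGrading (𝕜 : Type*) (G : Type*) (ι : Type*) [Field 𝕜] [LieRing G]
    [LieAlgebra 𝕜 G] [AddCommGroup ι] [DecidableEq ι] where
  /-- the homogeneous component of degree `i` -/
  comp : ι → Submodule 𝕜 G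
  isInternal : DirectSum.IsInternal comp
  lie_mem : ∀ {i j : ι} {x y : G}, x ∈ comp i → y ∈ comp j → ⁅x, y⁆ ∈ comp (i + j)

/-- `G`, with the `ℤ^n`-grading `𝒢`, is an exp-polynomial Lie algebra with distinguished spanning
set `g_k(α)`, `k ∈ K`, `α ∈ ℤ^n`.  The family `f k r : K →₀ _` collects the structure functions
`f_{k,r}^s(α, β)`, finitely many of which are nonzero for given `k` and `r`; the `2n` variables
are indexed by `Fin n ⊕ Fin n`. -/
structure IsExpPolynomialLie {𝕜 G K : Type*} [Field 𝕜] [LieRing G] [LieAlgebra 𝕜 G] {n : ℕ}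
    (𝒢 : LieGrading 𝕜 G (Fin n → ℤ)) (g : K → (Fin n → ℤ) → G) : Prop where
  mem_comp : ∀ k α, g k α ∈ 𝒢.comp α
  span_eq_top : Submodule.span 𝕜 {x | ∃ k α, x = g k α} = ⊤
  bracket : ∃ f : K → K → K →₀ expPolynomial 𝕜 (Fin n ⊕ Fin n), ∀ k r α β,
    ⁅g k α, g r β⁆ =
      (f k r).sum fun s h => (h : (Fin n ⊕ Fin n → ℤ) → 𝕜) (Sum.elim α β) • g s (α + β)

/-- The exp-polynomial Lie algebra `G` is `ℤ^n`-extragraded: it has a second grading `𝒵`, by `ℤ`,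
and `K` is the disjoint union of the finite sets `K_i = {k | deg k = i}`, where the `g_k(α)` with
`k ∈ K_i` are homogeneous of degree `i` for `𝒵` and span `G^(i)`. -/
structure IsExtragraded {𝕜 G K : Type*} [Field 𝕜] [LieRing G] [LieAlgebra 𝕜 G] {n : ℕ}
    (𝒢 : LieGrading 𝕜 G (Fin n → ℤ)) (𝒵 : LieGrading 𝕜 G ℤ)
    (deg : K → ℤ) (g : K → (Fin n → ℤ) → G) : Prop
    extends IsExpPolynomialLie 𝒢 g where
  finite_deg : ∀ i : ℤ, {k | deg k = i}.Finite
  mem_deg : ∀ k α, g k α ∈ 𝒵.comp (deg k)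
  span_deg : ∀ i : ℤ, Submodule.span 𝕜 {x | ∃ k α, deg k = i ∧ x = g k α} = 𝒵.comp i

/-- The module `V` over the Lie algebra `L` with distinguished spanning set `g_k(α)` is a
finite-dimensional exp-polynomial module. -/
def IsFiniteExpPolynomialModule (𝕜 : Type*) {L K : Type*} (V : Type*) [Field 𝕜] [LieRing L]
    [LieAlgebra 𝕜 L] [AddCommGroup V] [Module 𝕜 V] [LieRingModule L V] [LieModule 𝕜 L V]
    {n : ℕ} (g : K → (Fin n → ℤ) → L) : Prop :=
  ∃ (d : ℕ) (v : Module.Basis (Fin d) 𝕜 V) (h : K → Fin d → Fin d → expPolynomial 𝕜 (Fin n)),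
    ∀ k α j, ⁅g k α, v j⁆ = ∑ s, (h k j s : (Fin n → ℤ) → 𝕜) α • v s

namespace LieGrading

section

variable {𝕜 G : Type*} [Field 𝕜] [LieRing G] [LieAlgebra 𝕜 G] (𝒵 : LieGrading 𝕜 G ℤ)

/-- The subalgebra `G^(0)`. -/
def zeroPart : LieSubalgebra 𝕜 G :=
  { 𝒵.comp 0 with
    lie_mem' := fun {x y} hx hy => by
      have h := 𝒵.lie_mem (i := 0) (j := 0) hx hy
      rwa [add_zero] at h }

/-- The subalgebra `G^(0) + G^+`, the sum of the `G^(i)` with `i ≥ 0`. -/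
def nonnegPart : LieSubalgebra 𝕜 G :=
  { (⨆ i : {i : ℤ // 0 ≤ i}, 𝒵.comp i) with
    lie_mem' := fun {x y} hx hy => by
      change ⁅x, y⁆ ∈ (⨆ i : {i : ℤ // 0 ≤ i}, 𝒵.comp i)
      change x ∈ (⨆ i : {i : ℤ // 0 ≤ i}, 𝒵.comp i) at hx
      change y ∈ (⨆ i : {i : ℤ // 0 ≤ i}, 𝒵.comp i) at hy
      induction hx using Submodule.iSup_induction' with
      | zero => rw [zero_lie]; exact zero_mem _
      | add a b _ _ ha hb => rw [add_lie]; exact add_mem ha hb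
      | mem i a ha =>
        induction hy using Submodule.iSup_induction' with
        | zero => rw [lie_zero]; exact zero_mem _
        | add c d _ _ hc hd => rw [lie_add]; exact add_mem hc hd
        | mem j c hc =>
          exact Submodule.mem_iSup_of_mem (p := fun i : {i : ℤ // 0 ≤ i} => 𝒵.comp i)
            ⟨i.1 + j.1, add_nonneg i.2 j.2⟩ (𝒵.lie_mem ha hc) }

/-- The projection of `G` onto the homogeneous component `G^(i)`. -/
noncomputable def proj (i : ℤ) : G →ₗ[𝕜] 𝒵.comp i :=
  DirectSum.component 𝕜 ℤ (fun i => 𝒵.comp i) i ∘ₗ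
    (LinearEquiv.ofBijective (DirectSum.coeLinearMap 𝒵.comp) 𝒵.isInternal).symm.toLinearMap

lemma proj_of_mem {i : ℤ} {x : G} (hx : x ∈ 𝒵.comp i) : 𝒵.proj i x = ⟨x, hx⟩ :=
  𝒵.isInternal.ofBijective_coeLinearMap_of_mem hx

lemma proj_of_mem_ne {i j : ℤ} {x : G} (hx : x ∈ 𝒵.comp j) (h : j ≠ i) : 𝒵.proj i x = 0 :=
  𝒵.isInternal.ofBijective_coeLinearMap_of_mem_ne h hx

/-- The projection `G^(0) + G^+ → G^(0)` along the ideal `G^+`, as a Lie algebra homomorphism. -/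
noncomputable def toZeroPart : 𝒵.nonnegPart →ₗ⁅𝕜⁆ 𝒵.zeroPart :=
  { toFun := fun x => (⟨𝒵.proj 0 (x : G), (𝒵.proj 0 (x : G)).2⟩ : 𝒵.zeroPart)
    map_add' := fun x y => by
      apply Subtype.ext
      simp
    map_smul' := fun c x => by
      apply Subtype.ext
      simp
    map_lie' := fun {x y} => by
      apply Subtype.ext
      obtain ⟨x, hx⟩ := x
      obtain ⟨y, hy⟩ := y
      change ((𝒵.proj 0 ⁅x, y⁆ : 𝒵.comp 0) : G) =
        ⁅((𝒵.proj 0 x : 𝒵.comp 0) : G), ((𝒵.proj 0 y : 𝒵.comp 0) : G)⁆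
      change x ∈ (⨆ i : {i : ℤ // 0 ≤ i}, 𝒵.comp i) at hx
      change y ∈ (⨆ i : {i : ℤ // 0 ≤ i}, 𝒵.comp i) at hy
      induction hx using Submodule.iSup_induction' with
      | zero => simp
      | add a b _ _ ha hb => simp only [add_lie, map_add, Submodule.coe_add, ha, hb]
      | mem i a ha =>
        induction hy using Submodule.iSup_induction' with
        | zero => simp
        | add c d _ _ hc hd => simp only [lie_add, map_add, Submodule.coe_add, hc, hd]
        | mem j c hc =>
          obtain ⟨i, hi⟩ := i
          obtain ⟨j, hj⟩ := j
          change a ∈ 𝒵.comp i at ha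
          change c ∈ 𝒵.comp j at hc
          have hac := 𝒵.lie_mem ha hc
          by_cases hi0 : i = 0
          · subst hi0
            by_cases hj0 : j = 0
            · subst hj0
              rw [add_zero] at hac
              rw [𝒵.proj_of_mem hac, 𝒵.proj_of_mem ha, 𝒵.proj_of_mem hc]
            · rw [𝒵.proj_of_mem_ne hac (by omega), 𝒵.proj_of_mem_ne hc hj0]
              simp
          · rw [𝒵.proj_of_mem_ne hac (by omega), 𝒵.proj_of_mem_ne ha hi0]
            simp }

/-- The `ℤ`-grading of the universal enveloping algebra `U(G)` induced by that of `G`: the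
component of degree `i` is spanned by the products of homogeneous elements of `G` (possibly the
empty product `1`) whose degrees add up to `i`. -/
def envelopingComp (i : ℤ) : Submodule 𝕜 (UniversalEnvelopingAlgebra 𝕜 G) :=
  Submodule.span 𝕜 {u | ∃ l : List (ℤ × G), (∀ p ∈ l, p.2 ∈ 𝒵.comp p.1) ∧
    (l.map Prod.fst).sum = i ∧
    u = (l.map fun p => UniversalEnvelopingAlgebra.ι 𝕜 p.2).prod}

end

end LieGrading

/-- The distinguished spanning set `g_k(α)`, `k ∈ K_0`, of `G^(0)`. -/
def IsExtragraded.zeroFamily {𝕜 G K : Type*} [Field 𝕜] [LieRing G] [LieAlgebra 𝕜 G] {n : ℕ}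
    {𝒢 : LieGrading 𝕜 G (Fin n → ℤ)} {𝒵 : LieGrading 𝕜 G ℤ} {deg : K → ℤ}
    {g : K → (Fin n → ℤ) → G} (hG : IsExtragraded 𝒢 𝒵 deg g) :
    {k : K // deg k = 0} → (Fin n → ℤ) → 𝒵.zeroPart :=
  fun k α => ⟨g k α, by
    have h := hG.mem_deg k α
    rw [k.2] at h
    exact h⟩

section Induced

attribute [local instance] LieRing.ofAssociativeRing

variable {𝕜 G : Type*} [Field 𝕜] [LieRing G] [LieAlgebra 𝕜 G]
  {V : Type*} [AddCommGroup V] [Module 𝕜 V]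

/-- The left `U(G)`-submodule of `U(G) ⊗_𝕜 V` by which one divides to obtain `U(G) ⊗_{U(H)} V`,
for a representation `ρ` on `V` of a subalgebra `H` of `G`.  (`U(H)` is generated by `H`.) -/
def inducedRelations (H : LieSubalgebra 𝕜 G) (ρ : H →ₗ⁅𝕜⁆ Module.End 𝕜 V) :
    Submodule (UniversalEnvelopingAlgebra 𝕜 G) (UniversalEnvelopingAlgebra 𝕜 G ⊗[𝕜] V) :=
  Submodule.span _ {z | ∃ (u : UniversalEnvelopingAlgebra 𝕜 G) (x : H) (v : V),
    z = (u * UniversalEnvelopingAlgebra.ι 𝕜 (x : G)) ⊗ₜ[𝕜] v - u ⊗ₜ[𝕜] (ρ x v)}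

/-- The induced module `Ind_H^G V = U(G) ⊗_{U(H)} V`.  A `G`-module is regarded throughout as a
left module over `U(G)`, on which `x ∈ G` acts as `ι x ∈ U(G)`. -/
abbrev InducedModule (H : LieSubalgebra 𝕜 G) (ρ : H →ₗ⁅𝕜⁆ Module.End 𝕜 V) :=
  (UniversalEnvelopingAlgebra 𝕜 G ⊗[𝕜] V) ⧸ inducedRelations H ρ

end Induced

section GeneralizedVerma

attribute [local instance] LieRing.ofAssociativeRing

variable {𝕜 G : Type*} [Field 𝕜] [LieRing G] [LieAlgebra 𝕜 G] (𝒵 : LieGrading 𝕜 G ℤ)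
  (V : Type*) [AddCommGroup V] [Module 𝕜 V] [LieRingModule 𝒵.zeroPart V]
  [LieModule 𝕜 𝒵.zeroPart V]

/-- The `G^(0)`-module `V` as a representation of `G^(0) + G^+` on which `G^+` acts by zero. -/
noncomputable def inflatedRep : 𝒵.nonnegPart →ₗ⁅𝕜⁆ Module.End 𝕜 V :=
  (LieModule.toEnd 𝕜 𝒵.zeroPart V).comp 𝒵.toZeroPart

/-- `M̃(V)`, the `G`-module induced from the `(G^(0) + G^+)`-module `V`. -/
abbrev MTilde := InducedModule 𝒵.nonnegPart (inflatedRep 𝒵 V)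

/-- The map `V → M̃(V)`, `v ↦ 1 ⊗ v`. -/
noncomputable def toMTilde : V →ₗ[𝕜] MTilde 𝒵 V :=
  ((inducedRelations 𝒵.nonnegPart (inflatedRep 𝒵 V)).mkQ.restrictScalars 𝕜) ∘ₗ
    TensorProduct.mk 𝕜 (UniversalEnvelopingAlgebra 𝕜 G) V 1

/-- The component `M̃(V)^(i)`, spanned by the `u ⊗ v` with `u ∈ U(G)` of degree `i` and `v ∈ V`
(the elements of `V` have degree `0`). -/
noncomputable def MTildeComp (i : ℤ) : Submodule 𝕜 (MTilde 𝒵 V) :=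
  Submodule.span 𝕜 {m | ∃ u ∈ 𝒵.envelopingComp i, ∃ v : V, m = u • toMTilde 𝒵 V v}

/-- The `G`-submodule `N` of `M̃(V)` is graded: it is the sum of its intersections with the
homogeneous components. -/
def IsGradedSubmodule (N : Submodule (UniversalEnvelopingAlgebra 𝕜 G) (MTilde 𝒵 V)) : Prop :=
  N.restrictScalars 𝕜 = ⨆ i : ℤ, N.restrictScalars 𝕜 ⊓ MTildeComp 𝒵 V i

/-- `M̃^rad`, the largest graded submodule of `M̃(V)` which intersects `V` trivially, obtained as
the sum of all of them. -/
noncomputable def MTildeRad : Submodule (UniversalEnvelopingAlgebra 𝕜 G) (MTilde 𝒵 V) :=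
  sSup {N | IsGradedSubmodule 𝒵 V N ∧
    N.restrictScalars 𝕜 ⊓ LinearMap.range (toMTilde 𝒵 V) = ⊥}

/-- `M(V) = M̃(V) / M̃^rad`. -/
abbrev MQuot := MTilde 𝒵 V ⧸ MTildeRad 𝒵 V

/-- The component `M(V)^(i)`, the image of `M̃(V)^(i)`. -/
noncomputable def MQuotComp (i : ℤ) : Submodule 𝕜 (MQuot 𝒵 V) :=
  (MTildeComp 𝒵 V i).map ((MTildeRad 𝒵 V).mkQ.restrictScalars 𝕜)

end GeneralizedVerma

/-- The subspaces `ℳ i` form a `ℤ`-grading of the `G`-module `M`: `M` is their direct sum and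
`G^(i) ℳ_j ⊆ ℳ_{i+j}`. -/
structure IsModuleGrading {𝕜 G : Type*} [Field 𝕜] [LieRing G] [LieAlgebra 𝕜 G]
    (𝒵 : LieGrading 𝕜 G ℤ) {M : Type*} [AddCommGroup M] [Module 𝕜 M]
    [Module (UniversalEnvelopingAlgebra 𝕜 G) M] (ℳ : ℤ → Submodule 𝕜 M) : Prop where
  isInternal : DirectSum.IsInternal ℳ
  smul_mem : ∀ {i j : ℤ} {x : G} {m : M}, x ∈ 𝒵.comp i → m ∈ ℳ j →
    UniversalEnvelopingAlgebra.ι 𝕜 x • m ∈ ℳ (i + j)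

/-! The gradings are detected by a scaling. Multiplying `G^(i)` by `2 ^ i` is an automorphism of
`G`; it extends to `U(G)`, descends to `M̃(V)`, preserves the graded radical and so descends to
`M(V)`. The homogeneous components lie in eigenspaces for the scalars `2 ^ i`, distinct in
characteristic zero, hence are independent. That they span is formal.

Finiteness comes from functions of finite rank. For a word `g_{k₁}(A₁(x)) ⋯ g_{kₚ}(Aₚ(x)) v_j`, with
parameters depending on `x`, the claim is that its value in `M(V)` is a finite sum `∑ qₐ(x) mₐ`,
with scalar functions `qₐ` in a prescribed algebra `E` and fixed vectors `mₐ`. `M(V)^(i)` is spanned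
by the values of finitely many such words, since letters of negative degree suffice and these bound
both the length and the individual degrees.

In nonnegative degree the claim follows by moving a letter of nonnegative degree to the right:
commutators give shorter words, and on `V` the letter acts by zero or by exp-polynomials
(`word_mem_coeffFunctions_of_nonneg`). In negative degree one climbs (`word_mem_coeffFunctions`).
Modulo the radical, a vector of degree `i < 0` is determined by its images under the `g_k(y)` with
`0 < deg k ≤ -i` (`IsExtragraded.mem_MTildeRad`), and only finitely many `k` occur. Each longer word
`g_k(y) ⋯ v_j` has larger degree, so by induction it is a finite sum of terms `p(y) q(x) m`. The
functions `q` that occur are finitely many and control all linear relations among the values of the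
original word, whatever `y` is, which forces finite rank (`mem_coeffFunctions_of_separating`). -/

/-! ### Vector-valued functions of finite rank and separation of variables. -/

section FiniteRank

/-- Precomposition with `φ : X → Y`, as a homomorphism of function algebras. -/
def precompAlgHom (𝕜 : Type*) [Field 𝕜] {X Y : Type*} (φ : X → Y) : (Y → 𝕜) →ₐ[𝕜] (X → 𝕜) :=
  AlgHom.pi fun x => Pi.evalAlgHom 𝕜 (fun _ : Y => 𝕜) (φ x)

@[simp] lemma precompAlgHom_apply {𝕜 : Type*} [Field 𝕜] {X Y : Type*} (φ : X → Y) (f : Y → 𝕜)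
    (x : X) : precompAlgHom 𝕜 φ f x = f (φ x) := rfl

variable {𝕜 X Y M : Type*} [Field 𝕜] [AddCommGroup M] [Module 𝕜 M]

/-- The functions `X → M` of the form `x ↦ ∑ₐ qₐ(x) mₐ` (finite sums) with `qₐ ∈ E`, `mₐ ∈ M`. -/
def coeffFunctions (E : Subalgebra 𝕜 (X → 𝕜)) (M : Type*) [AddCommGroup M] [Module 𝕜 M] :
    Submodule 𝕜 (X → M) :=
  Submodule.span 𝕜 {F | ∃ q ∈ E, ∃ m : M, F = fun x => q x • m}

lemma smul_mem_coeffFunctions {E : Subalgebra 𝕜 (X → 𝕜)} {q : X → 𝕜} (hq : q ∈ E) {F : X → M}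
    (hF : F ∈ coeffFunctions E M) : (fun x => q x • F x) ∈ coeffFunctions E M := by
  induction hF using Submodule.span_induction with
  | mem F h =>
    obtain ⟨r, hr, m, rfl⟩ := h
    refine Submodule.subset_span ⟨q * r, mul_mem hq hr, m, ?_⟩
    funext x
    simp [mul_smul]
  | zero =>
    convert Submodule.zero_mem (coeffFunctions E M) using 1
    funext x
    simp
  | add F₁ F₂ _ _ h₁ h₂ =>
    convert Submodule.add_mem _ h₁ h₂ using 1
    funext x
    simp
  | smul c F _ h =>
    convert Submodule.smul_mem _ c h using 1
    funext x
    simp [smul_comm c]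

lemma const_mem_coeffFunctions (E : Subalgebra 𝕜 (X → 𝕜)) (m : M) :
    (fun _ => m) ∈ coeffFunctions E M :=
  Submodule.subset_span ⟨1, one_mem E, m, by simp⟩

/-- The values of a function of finite rank span a finite-dimensional space. -/
lemma exists_finiteDimensional_of_mem_coeffFunctions {E : Subalgebra 𝕜 (X → 𝕜)} {F : X → M}
    (hF : F ∈ coeffFunctions E M) :
    ∃ W : Submodule 𝕜 M, FiniteDimensional 𝕜 W ∧ ∀ x, F x ∈ W := by
  induction hF using Submodule.span_induction with
  | mem F h =>
    obtain ⟨q, -, m, rfl⟩ := h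
    exact ⟨Submodule.span 𝕜 {m}, inferInstance, fun x =>
      Submodule.smul_mem _ _ (Submodule.mem_span_singleton_self m)⟩
  | zero => exact ⟨⊥, inferInstance, fun x => by simp⟩
  | add F₁ F₂ _ _ h₁ h₂ =>
    obtain ⟨W₁, _, h₁⟩ := h₁
    obtain ⟨W₂, _, h₂⟩ := h₂
    exact ⟨W₁ ⊔ W₂, inferInstance, fun x => Submodule.add_mem_sup (h₁ x) (h₂ x)⟩
  | smul c F _ h =>
    obtain ⟨W, hW, h⟩ := h
    exact ⟨W, hW, fun x => W.smul_mem c (h x)⟩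

/-- The functions on `Y × X` which are sums of products of a function on `Y` and a function
from `E` on `X`. -/
def prodSubalgebra (Y : Type*) (E : Subalgebra 𝕜 (X → 𝕜)) : Subalgebra 𝕜 (Y × X → 𝕜) :=
  (⊤ : Subalgebra 𝕜 (Y → 𝕜)).map (precompAlgHom 𝕜 Prod.fst) ⊔
    E.map (precompAlgHom 𝕜 Prod.snd)

lemma comp_fst_mem_prodSubalgebra (E : Subalgebra 𝕜 (X → 𝕜)) (p : Y → 𝕜) :
    (fun z => p z.1) ∈ prodSubalgebra Y E :=
  (le_sup_left : _ ≤ prodSubalgebra Y E) ⟨p, trivial, rfl⟩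

lemma comp_snd_mem_prodSubalgebra {E : Subalgebra 𝕜 (X → 𝕜)} {q : X → 𝕜} (hq : q ∈ E) :
    (fun z => q z.2) ∈ prodSubalgebra Y E :=
  (le_sup_right : _ ≤ prodSubalgebra Y E) ⟨q, hq, rfl⟩

/-- A scalar function from `prodSubalgebra Y E` separates into finitely many functions of `E`. -/
lemma exists_finset_of_mem_prodSubalgebra {E : Subalgebra 𝕜 (X → 𝕜)} {r : Y × X → 𝕜}
    (hr : r ∈ prodSubalgebra Y E) :
    ∃ s : Finset (X → 𝕜), (∀ q ∈ s, q ∈ E) ∧ ∀ c : X →₀ 𝕜,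
      (∀ q ∈ s, Finsupp.linearCombination 𝕜 q c = 0) →
        ∀ y, Finsupp.linearCombination 𝕜 (fun x => r (y, x)) c = 0 := by
  classical
  -- The join of two commuting subalgebras is their product, so `r` is a finite sum of terms `p(y)
  -- q(x)`; the set `s` collects the factors `q`.
  rw [prodSubalgebra, ← Subalgebra.mem_toSubmodule, ← Subalgebra.mul_toSubmodule] at hr
  induction hr using Submodule.mul_induction_on' with
  | mem_mul_mem a ha b hb =>
    obtain ⟨p, -, rfl⟩ := ha
    obtain ⟨q, hq, rfl⟩ := hb
    refine ⟨{q}, by simpa using hq, fun c hc y => ?_⟩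
    have h := hc q (by simp)
    rw [Finsupp.linearCombination_apply, Finsupp.sum] at h ⊢
    calc _ = p y * ∑ x ∈ c.support, c x • q x := by
          rw [Finset.mul_sum]
          refine Finset.sum_congr rfl fun x _ => ?_
          simp [mul_left_comm]
      _ = 0 := by rw [h, mul_zero]
  | add a _ b _ ha hb =>
    obtain ⟨s, hs, hs'⟩ := ha
    obtain ⟨t, ht, ht'⟩ := hb
    refine ⟨s ∪ t, fun q hq => (Finset.mem_union.1 hq).elim (hs q) (ht q), fun c hc y => ?_⟩
    have h₁ := hs' c (fun q hq => hc q (Finset.mem_union_left _ hq)) y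
    have h₂ := ht' c (fun q hq => hc q (Finset.mem_union_right _ hq)) y
    simp only [Finsupp.linearCombination_apply, Finsupp.sum] at h₁ h₂ ⊢
    simp [mul_add, Finset.sum_add_distrib] at h₁ h₂ ⊢
    rw [h₁, h₂, add_zero]

/-- A vector-valued function of finite rank over `prodSubalgebra Y E` separates into finitely many
functions of `E`. -/
lemma exists_finset_of_mem_coeffFunctions {E : Subalgebra 𝕜 (X → 𝕜)} {F : Y × X → M}
    (hF : F ∈ coeffFunctions (prodSubalgebra Y E) M) :
    ∃ s : Finset (X → 𝕜), (∀ q ∈ s, q ∈ E) ∧ ∀ c : X →₀ 𝕜,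
      (∀ q ∈ s, Finsupp.linearCombination 𝕜 q c = 0) →
        ∀ y, Finsupp.linearCombination 𝕜 (fun x => F (y, x)) c = 0 := by
  classical
  induction hF using Submodule.span_induction with
  | mem F h =>
    obtain ⟨r, hr, m, rfl⟩ := h
    obtain ⟨s, hs, hs'⟩ := exists_finset_of_mem_prodSubalgebra hr
    refine ⟨s, hs, fun c hc y => ?_⟩
    have h := hs' c hc y
    rw [Finsupp.linearCombination_apply, Finsupp.sum] at h ⊢
    simp only [smul_smul, ← Finset.sum_smul]
    simp only [smul_eq_mul] at h
    rw [h, zero_smul]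
  | zero => exact ⟨∅, by simp, fun c _ y => by simp [Finsupp.linearCombination_apply]⟩
  | add F₁ F₂ _ _ h₁ h₂ =>
    obtain ⟨s, hs, hs'⟩ := h₁
    obtain ⟨t, ht, ht'⟩ := h₂
    refine ⟨s ∪ t, fun q hq => (Finset.mem_union.1 hq).elim (hs q) (ht q), fun c hc y => ?_⟩
    have h₁ := hs' c (fun q hq => hc q (Finset.mem_union_left _ hq)) y
    have h₂ := ht' c (fun q hq => hc q (Finset.mem_union_right _ hq)) y
    simp only [Finsupp.linearCombination_apply, Finsupp.sum] at h₁ h₂ ⊢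
    simp only [Pi.add_apply, smul_add, Finset.sum_add_distrib]
    rw [h₁, h₂, add_zero]
  | smul a F _ h =>
    obtain ⟨s, hs, hs'⟩ := h
    refine ⟨s, hs, fun c hc y => ?_⟩
    have h := hs' c hc y
    simp only [Finsupp.linearCombination_apply, Finsupp.sum] at h ⊢
    simp only [Pi.smul_apply, smul_comm _ a, ← Finset.smul_sum]
    rw [h, smul_zero]

/-- If all linear relations among the values of finitely many functions of `E` hold among the
values of `F`, then `F` is a combination of these functions. -/
lemma mem_coeffFunctions_of_relations {E : Subalgebra 𝕜 (X → 𝕜)} {F : X → M}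
    (s : Finset (X → 𝕜)) (hs : ∀ q ∈ s, q ∈ E)
    (h : ∀ c : X →₀ 𝕜, (∀ q ∈ s, Finsupp.linearCombination 𝕜 q c = 0) →
      Finsupp.linearCombination 𝕜 F c = 0) : F ∈ coeffFunctions E M := by
  classical
  let Ψ : (X →₀ 𝕜) →ₗ[𝕜] (s → 𝕜) :=
    LinearMap.pi fun q => Finsupp.linearCombination 𝕜 (q : X → 𝕜)
  have hker : LinearMap.ker Ψ ≤ LinearMap.ker (Finsupp.linearCombination 𝕜 F) := by
    intro c hc
    rw [LinearMap.mem_ker] at hc ⊢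
    exact h c fun q hq => congrFun hc ⟨q, hq⟩
  -- The combination of values of `F` factors through `Ψ`, a priori only on the range of `Ψ`; over a
  -- field it extends to all of `s → 𝕜`.
  obtain ⟨T, hT⟩ := LinearMap.exists_extend
    (((LinearMap.ker Ψ).liftQ _ hker) ∘ₗ Ψ.quotKerEquivRange.symm.toLinearMap)
  have hTΨ : ∀ c, T (Ψ c) = Finsupp.linearCombination 𝕜 F c := by
    intro c
    have h₁ := LinearMap.congr_fun hT ⟨Ψ c, LinearMap.mem_range_self Ψ c⟩
    have h₂ : Ψ.quotKerEquivRange.symm ⟨Ψ c, LinearMap.mem_range_self Ψ c⟩ =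
        Submodule.Quotient.mk c := by
      rw [LinearEquiv.symm_apply_eq]
      rfl
    simpa [h₂] using h₁
  have hF : F = ∑ q : s, fun x => (q : X → 𝕜) x • T (Pi.single q 1) := by
    funext x
    -- At the point mass at `x`, `Ψ` gives the vector `(q(x))_q`; expanding it in the standard basis
    -- expresses `F x` through the `q(x)`.
    have h₁ := hTΨ (Finsupp.single x 1)
    rw [Finsupp.linearCombination_single, one_smul, LinearMap.pi_apply_eq_sum_univ] at h₁
    rw [← h₁, Finset.sum_apply]
    refine Finset.sum_congr rfl fun q _ => ?_
    congr 1
    · simp [Ψ]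
    · congr 1
      funext r
      simp [Pi.single_apply, eq_comm]
  rw [hF]
  exact Submodule.sum_mem _ fun q _ => Submodule.subset_span ⟨q, hs _ q.2, _, rfl⟩

/-- If finitely many families `T l y` of operators jointly separate the points of a subspace
containing the values of `F`, and the functions `(y, x) ↦ T l y (F x)` are of finite rank, then
so is `F`. -/
lemma mem_coeffFunctions_of_separating {κ : Type*} {E : Subalgebra 𝕜 (X → 𝕜)} {F : X → M}
    (W : Submodule 𝕜 M) (hFW : ∀ x, F x ∈ W) (L : Finset κ) (T : κ → Y → Module.End 𝕜 M)
    (hT : ∀ m ∈ W, (∀ l ∈ L, ∀ y, T l y m = 0) → m = 0)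
    (hF : ∀ l ∈ L, (fun z : Y × X => T l z.1 (F z.2)) ∈ coeffFunctions (prodSubalgebra Y E) M) :
    F ∈ coeffFunctions E M := by
  classical
  choose! s hs hs' using fun l hl => exists_finset_of_mem_coeffFunctions (hF l hl)
  refine mem_coeffFunctions_of_relations (L.biUnion s) (fun q hq => ?_) fun c hc => ?_
  · obtain ⟨l, hl, hq⟩ := Finset.mem_biUnion.1 hq
    exact hs l hl q hq
  -- The combination of values of `F` stays in `W` and is killed by every `T l y`, hence vanishes.
  · refine hT _ ?_ fun l hl y => ?_
    · rw [Finsupp.linearCombination_apply]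
      exact Submodule.sum_mem _ fun x _ => W.smul_mem _ (hFW x)
    · have h := hs' l hl c (fun q hq => hc q (Finset.mem_biUnion.2 ⟨l, hl, hq⟩)) y
      rw [Finsupp.linearCombination_apply, Finsupp.sum] at h ⊢
      simpa using h

end FiniteRank

/-! ### Parameter maps along which exp-polynomials pull back into a given algebra. -/

section Admissible

variable {𝕜 X : Type*} [Field 𝕜]

/-- A map `A : X → ℤ^σ` such that the functions `x ↦ A(x)_j` and `x ↦ a ^ A(x)_j` belong
to `E`. -/
def IsAdmissible {σ : Type*} (E : Subalgebra 𝕜 (X → 𝕜)) (A : X → σ → ℤ) : Prop :=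
  ∀ j, (fun x => ((A x j : ℤ) : 𝕜)) ∈ E ∧ ∀ a : 𝕜, a ≠ 0 → (fun x => a ^ (A x j)) ∈ E

lemma IsAdmissible.comp_mem {σ : Type*} {E : Subalgebra 𝕜 (X → 𝕜)} {A : X → σ → ℤ}
    (hA : IsAdmissible E A) {f : (σ → ℤ) → 𝕜} (hf : f ∈ expPolynomial 𝕜 σ) :
    (fun x => f (A x)) ∈ E := by
  have h : expPolynomial 𝕜 σ ≤ E.comap (precompAlgHom 𝕜 A) := by
    refine Algebra.adjoin_le ?_
    rintro f (⟨j, rfl⟩ | ⟨j, a, ha, rfl⟩)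
    · exact (hA j).1
    · exact (hA j).2 a ha
  exact h hf

lemma IsAdmissible.add {σ : Type*} {E : Subalgebra 𝕜 (X → 𝕜)} {A B : X → σ → ℤ}
    (hA : IsAdmissible E A) (hB : IsAdmissible E B) : IsAdmissible E (fun x => A x + B x) := by
  refine fun j => ⟨?_, fun a ha => ?_⟩
  · convert add_mem (hA j).1 (hB j).1 using 1
    funext x
    simp
  · convert mul_mem ((hA j).2 a ha) ((hB j).2 a ha) using 1
    funext x
    simp [zpow_add₀ ha]

lemma IsAdmissible.sumElim {σ τ : Type*} {E : Subalgebra 𝕜 (X → 𝕜)} {A : X → σ → ℤ}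
    {B : X → τ → ℤ} (hA : IsAdmissible E A) (hB : IsAdmissible E B) :
    IsAdmissible E (fun x => Sum.elim (A x) (B x)) := by
  rintro (j | j)
  · exact hA j
  · exact hB j

lemma IsAdmissible.comp_snd {Y σ : Type*} {E : Subalgebra 𝕜 (X → 𝕜)} {A : X → σ → ℤ}
    (hA : IsAdmissible E A) :
    IsAdmissible (prodSubalgebra Y E) (fun z : Y × X => A z.2) :=
  fun j => ⟨comp_snd_mem_prodSubalgebra (hA j).1,
    fun a ha => comp_snd_mem_prodSubalgebra ((hA j).2 a ha)⟩

/-- This adjoins a new independent variable: `prodSubalgebra` puts no restriction on the dependence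
on its first factor. -/
lemma isAdmissible_fst {σ : Type*} (E : Subalgebra 𝕜 (X → 𝕜)) :
    IsAdmissible (prodSubalgebra (σ → ℤ) E) (fun z : (σ → ℤ) × X => z.1) :=
  fun j => ⟨comp_fst_mem_prodSubalgebra E fun y : σ → ℤ => ((y j : ℤ) : 𝕜),
    fun a _ => comp_fst_mem_prodSubalgebra E fun y : σ → ℤ => a ^ (y j)⟩

end Admissible

/-! ### Words in the generators have finite rank. -/

section Words

attribute [local instance] LieRing.ofAssociativeRing

variable {𝕜 G K M X J : Type*} [Field 𝕜] [LieRing G] [LieAlgebra 𝕜 G] [AddCommGroup M]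
  [Module 𝕜 M] {n : ℕ}

/-- The structure functions of an extragraded Lie algebra can be chosen homogeneous. -/
lemma IsExtragraded.exists_homogeneous_bracket {𝒢 : LieGrading 𝕜 G (Fin n → ℤ)}
    {𝒵 : LieGrading 𝕜 G ℤ} {deg : K → ℤ} {g : K → (Fin n → ℤ) → G}
    (hG : IsExtragraded 𝒢 𝒵 deg g) :
    ∃ f : K → K → K →₀ expPolynomial 𝕜 (Fin n ⊕ Fin n),
      (∀ k r, ∀ s ∈ (f k r).support, deg s = deg k + deg r) ∧
      ∀ k r α β, ⁅g k α, g r β⁆ =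
        (f k r).sum fun s h => (h : (Fin n ⊕ Fin n → ℤ) → 𝕜) (Sum.elim α β) • g s (α + β) := by
  classical
  obtain ⟨f, hf⟩ := hG.bracket
  refine ⟨fun k r => (f k r).filter fun s => deg s = deg k + deg r, fun k r s hs => ?_,
    fun k r α β => ?_⟩
  · rw [Finsupp.support_filter, Finset.mem_filter] at hs
    exact hs.2
  · have h := 𝒵.lie_mem (hG.mem_deg k α) (hG.mem_deg r β)
    have h₁ : ((𝒵.proj (deg k + deg r) ⁅g k α, g r β⁆ : 𝒵.comp (deg k + deg r)) : G) =
        ⁅g k α, g r β⁆ := congrArg Subtype.val (𝒵.proj_of_mem h)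
    -- Projecting the given expansion to degree `deg k + deg r` leaves the bracket unchanged and
    -- removes exactly the terms of other degrees.
    refine h₁.symm.trans ?_
    rw [hf, Finsupp.sum, Finsupp.sum, Finsupp.support_filter, Finset.sum_filter, map_sum,
      AddSubmonoidClass.coe_finsetSum]
    refine Finset.sum_congr rfl fun s _ => ?_
    rw [map_smul, Submodule.coe_smul]
    split_ifs with hs
    · beta_reduce
      rw [Finsupp.filter_apply_pos (fun s => deg s = deg k + deg r) _ hs,
        𝒵.proj_of_mem (hs ▸ hG.mem_deg s _)]
    · rw [𝒵.proj_of_mem_ne (hG.mem_deg s _) hs]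
      simp

/-- The operator `g_{k₁}(A₁(x)) ⋯ g_{kₚ}(Aₚ(x))` attached to a word with letters `(kᵢ, Aᵢ)`. -/
def wordOp (ρ : G →ₗ⁅𝕜⁆ Module.End 𝕜 M) (g : K → (Fin n → ℤ) → G)
    (w : List (K × (X → Fin n → ℤ))) (x : X) : Module.End 𝕜 M :=
  (w.map fun c => ρ (g c.1 (c.2 x))).prod

/-- The degree of a word. -/
def wordDeg (deg : K → ℤ) (w : List (K × (X → Fin n → ℤ))) : ℤ :=
  (w.map fun c => deg c.1).sum

variable {ρ : G →ₗ⁅𝕜⁆ Module.End 𝕜 M} {g : K → (Fin n → ℤ) → G} {deg : K → ℤ}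

lemma wordOp_append (u t : List (K × (X → Fin n → ℤ))) (x : X) :
    wordOp ρ g (u ++ t) x = wordOp ρ g u x * wordOp ρ g t x := by
  simp [wordOp]

lemma wordOp_cons (c : K × (X → Fin n → ℤ)) (t : List (K × (X → Fin n → ℤ))) (x : X) :
    wordOp ρ g (c :: t) x = ρ (g c.1 (c.2 x)) * wordOp ρ g t x := by
  simp [wordOp]

@[simp] lemma wordOp_nil (x : X) :
    wordOp ρ g ([] : List (K × (X → Fin n → ℤ))) x = 1 := rfl

lemma wordDeg_append (u t : List (K × (X → Fin n → ℤ))) :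
    wordDeg deg (u ++ t) = wordDeg deg u + wordDeg deg t := by
  simp [wordDeg]

lemma wordDeg_cons (c : K × (X → Fin n → ℤ)) (t : List (K × (X → Fin n → ℤ))) :
    wordDeg deg (c :: t) = deg c.1 + wordDeg deg t := by
  simp [wordDeg]

@[simp] lemma wordDeg_nil : wordDeg deg ([] : List (K × (X → Fin n → ℤ))) = 0 := rfl

lemma wordOp_mem {ℳ : ℤ → Submodule 𝕜 M}
    (hℳ : ∀ k α i, ∀ m ∈ ℳ i, ρ (g k α) m ∈ ℳ (deg k + i)) (w : List (K × (X → Fin n → ℤ)))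
    (x : X) {i : ℤ} {m : M} (hm : m ∈ ℳ i) : wordOp ρ g w x m ∈ ℳ (wordDeg deg w + i) := by
  induction w with
  | nil => simpa using hm
  | cons c t ih =>
    rw [wordOp_cons, wordDeg_cons, add_assoc]
    exact hℳ _ _ _ _ ih

/-- If the `g_k(α)` of positive degree kill the `v_j` and those of degree `0` act on them by
exp-polynomial functions, then all words of nonnegative degree give functions of finite rank. -/
lemma word_mem_coeffFunctions_of_nonneg [Fintype J]
    {f : K → K → K →₀ expPolynomial 𝕜 (Fin n ⊕ Fin n)}
    (hf : ∀ k r, ∀ s ∈ (f k r).support, deg s = deg k + deg r)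
    (hbr : ∀ k r α β, ⁅g k α, g r β⁆ =
      (f k r).sum fun s h => (h : (Fin n ⊕ Fin n → ℤ) → 𝕜) (Sum.elim α β) • g s (α + β))
    {v : J → M} (hpos : ∀ k α j, 0 < deg k → ρ (g k α) (v j) = 0)
    (hzero : ∀ k, deg k = 0 → ∃ h : J → J → expPolynomial 𝕜 (Fin n), ∀ α j,
      ρ (g k α) (v j) = ∑ s, (h j s : (Fin n → ℤ) → 𝕜) α • v s)
    (E : Subalgebra 𝕜 (X → 𝕜)) (p : ℕ) :
    ∀ w : List (K × (X → Fin n → ℤ)), w.length = p → (∀ c ∈ w, IsAdmissible E c.2) →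
      0 ≤ wordDeg deg w → ∀ j, (fun x => wordOp ρ g w x (v j)) ∈ coeffFunctions E M := by
  classical
  induction p with
  | zero =>
    intro w hw _ _ j
    obtain rfl := List.length_eq_zero_iff.1 hw
    exact const_mem_coeffFunctions E (v j)
  | succ p ih =>
    -- Induction on the part `t` to the right of the letter `c`. Exchanging `c` with its right
    -- neighbour shortens `t`, and the commutator terms are shorter words of the same total degree,
    -- covered by `ih`.
    have key : ∀ t u : List (K × (X → Fin n → ℤ)), ∀ c : K × (X → Fin n → ℤ), 0 ≤ deg c.1 →
        (u ++ c :: t).length = p + 1 → (∀ c' ∈ u ++ c :: t, IsAdmissible E c'.2) →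
        0 ≤ wordDeg deg (u ++ c :: t) →
        ∀ j, (fun x => wordOp ρ g (u ++ c :: t) x (v j)) ∈ coeffFunctions E M := by
      intro t
      induction t with
      | nil =>
        intro u c hc hlen hadm hdeg j
        rcases hc.lt_or_eq with hc | hc
        · convert Submodule.zero_mem (coeffFunctions E M) using 1
          funext x
          simp [wordOp_append, wordOp_cons, hpos _ _ _ hc]
        · obtain ⟨h, hh⟩ := hzero c.1 hc.symm
          have hcA : IsAdmissible E c.2 := hadm c (by simp)
          have hu : ∀ s, (fun x => wordOp ρ g u x (v s)) ∈ coeffFunctions E M := by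
            refine ih u ?_ (fun c' hc' => hadm c' (by simp [hc'])) ?_
            · simpa using hlen
            · simpa [wordDeg_append, wordDeg_cons, ← hc] using hdeg
          have heq : (fun x => wordOp ρ g (u ++ [c]) x (v j)) =
              ∑ s, fun x => (h j s : (Fin n → ℤ) → 𝕜) (c.2 x) • wordOp ρ g u x (v s) := by
            funext x
            simp [wordOp_append, wordOp_cons, hh]
          rw [heq]
          exact Submodule.sum_mem _ fun s _ =>
            smul_mem_coeffFunctions (hcA.comp_mem (h j s).2) (hu s)
      | cons b t iht =>
        intro u c hc hlen hadm hdeg j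
        have hcA : IsAdmissible E c.2 := hadm c (by simp)
        have hbA : IsAdmissible E b.2 := hadm b (by simp)
        have h₁ : (fun x => wordOp ρ g ((u ++ [b]) ++ c :: t) x (v j)) ∈ coeffFunctions E M := by
          refine iht (u ++ [b]) c hc ?_ (fun c' hc' => hadm c' ?_) ?_ j
          · simp at hlen ⊢
            omega
          · simp at hc' ⊢
            tauto
          · simp [wordDeg_append, wordDeg_cons] at hdeg ⊢
            omega
        have h₂ : ∀ s ∈ (f c.1 b.1).support,
            (fun x => wordOp ρ g (u ++ (s, fun x => c.2 x + b.2 x) :: t) x (v j)) ∈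
              coeffFunctions E M := by
          intro s hs
          refine ih _ ?_ (fun c' hc' => ?_) ?_ j
          · simp at hlen ⊢
            omega
          · rw [List.mem_append, List.mem_cons] at hc'
            rcases hc' with hc' | rfl | hc'
            · exact hadm c' (by simp [hc'])
            · exact hcA.add hbA
            · exact hadm c' (by simp [hc'])
          · have h := hf _ _ s hs
            simp [wordDeg_append, wordDeg_cons] at hdeg ⊢
            omega
        have heq : (fun x => wordOp ρ g (u ++ c :: b :: t) x (v j)) =
            (fun x => wordOp ρ g ((u ++ [b]) ++ c :: t) x (v j)) +
            ∑ s ∈ (f c.1 b.1).support, fun x =>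
              (f c.1 b.1 s : (Fin n ⊕ Fin n → ℤ) → 𝕜) (Sum.elim (c.2 x) (b.2 x)) •
                wordOp ρ g (u ++ (s, fun x => c.2 x + b.2 x) :: t) x (v j) := by
          funext x
          have h₃ : ρ (g c.1 (c.2 x)) * ρ (g b.1 (b.2 x)) =
              ρ (g b.1 (b.2 x)) * ρ (g c.1 (c.2 x)) + ∑ s ∈ (f c.1 b.1).support,
                (f c.1 b.1 s : (Fin n ⊕ Fin n → ℤ) → 𝕜) (Sum.elim (c.2 x) (b.2 x)) •
                  ρ (g s (c.2 x + b.2 x)) := by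
            have h₄ := congrArg ρ (hbr c.1 b.1 (c.2 x) (b.2 x))
            rw [LieHom.map_lie, LieRing.of_associative_ring_bracket, Finsupp.sum, map_sum] at h₄
            simp only [map_smul] at h₄
            rw [← h₄]
            abel
          simp only [wordOp_append, wordOp_cons, wordOp_nil, mul_one, Pi.add_apply,
            Finset.sum_apply]
          rw [← mul_assoc (ρ _) (ρ _), h₃]
          simp [mul_assoc, add_mul, mul_add, Finset.sum_mul, map_sum]
        rw [heq]
        exact Submodule.add_mem _ h₁ (Submodule.sum_mem _ fun s hs =>
          smul_mem_coeffFunctions ((hcA.sumElim hbA).comp_mem (f c.1 b.1 s).2) (h₂ s hs))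
    intro w hlen hadm hdeg j
    -- A nonempty word of nonnegative degree cannot have only letters of negative degree.
    obtain ⟨c, hcw, hc⟩ : ∃ c ∈ w, 0 ≤ deg c.1 := by
      by_contra! hneg
      have hw : ∀ w' : List (K × (X → Fin n → ℤ)), (∀ c ∈ w', deg c.1 < 0) → w' ≠ [] →
          wordDeg deg w' < 0 := by
        intro w'
        induction w' with
        | nil => simp
        | cons a l ihl =>
          intro h _
          rw [wordDeg_cons]
          have ha := h a (by simp)
          by_cases hl : l = []
          · simpa [hl] using ha
          · have := ihl (fun c hc => h c (by simp [hc])) hl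
            omega
      have := hw w hneg (by rintro rfl; simp at hlen)
      omega
    obtain ⟨u, t, rfl⟩ := List.mem_iff_append.1 hcw
    exact key t u c hc hlen hadm hdeg j

/-- If moreover `M` is graded in such a way that the vectors of negative degree are separated by
the operators of positive degree, then all words give functions of finite rank. -/
lemma word_mem_coeffFunctions {X : Type} [Fintype J]
    {f : K → K → K →₀ expPolynomial 𝕜 (Fin n ⊕ Fin n)}
    (hf : ∀ k r, ∀ s ∈ (f k r).support, deg s = deg k + deg r)
    (hbr : ∀ k r α β, ⁅g k α, g r β⁆ =
      (f k r).sum fun s h => (h : (Fin n ⊕ Fin n → ℤ) → 𝕜) (Sum.elim α β) • g s (α + β))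
    (hfin : ∀ i : ℤ, {k | deg k = i}.Finite)
    {v : J → M} (hpos : ∀ k α j, 0 < deg k → ρ (g k α) (v j) = 0)
    (hzero : ∀ k, deg k = 0 → ∃ h : J → J → expPolynomial 𝕜 (Fin n), ∀ α j,
      ρ (g k α) (v j) = ∑ s, (h j s : (Fin n → ℤ) → 𝕜) α • v s)
    {ℳ : ℤ → Submodule 𝕜 M} (hv : ∀ j, v j ∈ ℳ 0)
    (hℳ : ∀ k α i, ∀ m ∈ ℳ i, ρ (g k α) m ∈ ℳ (deg k + i))
    (hsep : ∀ i < 0, ∀ m ∈ ℳ i,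
      (∀ k α, 0 < deg k → deg k ≤ -i → ρ (g k α) m = 0) → m = 0)
    (E : Subalgebra 𝕜 (X → 𝕜)) (w : List (K × (X → Fin n → ℤ)))
    (hadm : ∀ c ∈ w, IsAdmissible E c.2) (j : J) :
    (fun x => wordOp ρ g w x (v j)) ∈ coeffFunctions E M := by
  have hmem : ∀ {X : Type} (w : List (K × (X → Fin n → ℤ))) (x : X) (j : J),
      wordOp ρ g w x (v j) ∈ ℳ (wordDeg deg w) := fun w x j => by
    simpa using wordOp_mem hℳ w x (hv j)
  -- The parameter space and the algebra vary in the induction on `d`, because each step replaces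
  -- `X` by `(Fin n → ℤ) × X`.
  have key : ∀ (d : ℕ) (X : Type) (E : Subalgebra 𝕜 (X → 𝕜)) (w : List (K × (X → Fin n → ℤ))),
      (∀ c ∈ w, IsAdmissible E c.2) → -(d : ℤ) ≤ wordDeg deg w →
        (fun x => wordOp ρ g w x (v j)) ∈ coeffFunctions E M := by
    intro d
    induction d with
    | zero =>
      intro X E w hadm hdeg
      exact word_mem_coeffFunctions_of_nonneg hf hbr hpos hzero E _ w rfl hadm
        (by simpa using hdeg) j
    | succ d ih =>
      intro X E w hadm hdeg
      by_cases hd : -(d : ℤ) ≤ wordDeg deg w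
      · exact ih X E w hadm hd
      have hL : {k | 0 < deg k ∧ deg k ≤ (d : ℤ) + 1}.Finite := by
        refine ((Set.finite_Icc (1 : ℤ) (d + 1)).biUnion fun i _ => hfin i).subset ?_
        intro k hk
        simp only [Set.mem_ofPred_eq] at hk
        simp only [Set.mem_iUnion, Set.mem_ofPred_eq, Set.mem_Icc]
        exact ⟨deg k, ⟨by omega, by omega⟩, rfl⟩
      -- Here the word has degree exactly `-(d + 1)`, so `hsep` needs only letters of degree from
      -- `1` to `d + 1`; prepending one raises the degree to at least `-d`.
      refine mem_coeffFunctions_of_separating (Y := Fin n → ℤ) (ℳ (wordDeg deg w))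
        (fun x => hmem w x j) hL.toFinset (fun k α => ρ (g k α)) (fun m hm h => ?_) fun k hk => ?_
      · refine hsep _ (by omega) m hm fun k α hk hk' => h k ?_ α
        simp only [Set.Finite.mem_toFinset, Set.mem_ofPred_eq]
        push_cast at hdeg
        omega
      · simp only [Set.Finite.mem_toFinset, Set.mem_ofPred_eq] at hk
        have := ih ((Fin n → ℤ) × X) (prodSubalgebra (Fin n → ℤ) E)
          ((k, Prod.fst) :: w.map fun c => (c.1, fun z => c.2 z.2)) (fun c hc => ?_) ?_
        · convert this using 2 with z
          rw [wordOp_cons]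
          simp [wordOp, Function.comp_def]
        · rw [List.mem_cons, List.mem_map] at hc
          rcases hc with rfl | ⟨c, hc, rfl⟩
          · exact isAdmissible_fst E
          · exact (hadm c hc).comp_snd
        · rw [wordDeg_cons]
          have : wordDeg deg (w.map fun c => (c.1, fun z : (Fin n → ℤ) × X => c.2 z.2)) =
              wordDeg deg w := by
            simp [wordDeg, Function.comp_def]
          rw [this]
          push_cast at hdeg ⊢
          omega
  exact key (wordDeg deg w).natAbs X E w hadm (by omega)

end Words

/-! ### The enveloping algebra and the scaling automorphism. -/

section Gradings

attribute [local instance] LieRing.ofAssociativeRing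

variable {𝕜 G : Type*} [Field 𝕜] [LieRing G] [LieAlgebra 𝕜 G]

namespace LieGrading

variable (𝒵 : LieGrading 𝕜 G ℤ)

/-- The linear map which multiplies the elements of `G^(i)` by `2 ^ i`. -/
noncomputable def scaleLinear : G →ₗ[𝕜] G :=
  DirectSum.toModule 𝕜 ℤ G (fun i => (2 : 𝕜) ^ i • (𝒵.comp i).subtype) ∘ₗ
    (LinearEquiv.ofBijective (DirectSum.coeLinearMap 𝒵.comp) 𝒵.isInternal).symm.toLinearMap

lemma scaleLinear_of_mem {i : ℤ} {x : G} (hx : x ∈ 𝒵.comp i) :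
    𝒵.scaleLinear x = (2 : 𝕜) ^ i • x := by
  have h : (LinearEquiv.ofBijective (DirectSum.coeLinearMap 𝒵.comp) 𝒵.isInternal).symm x =
      DirectSum.lof 𝕜 ℤ (fun i => 𝒵.comp i) i ⟨x, hx⟩ := by
    rw [LinearEquiv.symm_apply_eq]
    exact (DirectSum.coeLinearMap_lof 𝒵.comp i ⟨x, hx⟩).symm
  rw [scaleLinear, LinearMap.comp_apply, LinearEquiv.coe_coe, h, DirectSum.toModule_lof]
  rfl

@[elab_as_elim]
lemma induction_homogeneous {p : G → Prop} (x : G) (mem : ∀ i, ∀ y ∈ 𝒵.comp i, p y)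
    (zero : p 0) (add : ∀ y z, p y → p z → p (y + z)) : p x := by
  have hx : x ∈ ⨆ i, 𝒵.comp i := by
    rw [𝒵.isInternal.submodule_iSup_eq_top]
    trivial
  exact Submodule.iSup_induction (motive := p) _ hx mem zero add

/-- The automorphism of `G` which multiplies the elements of `G^(i)` by `2 ^ i`. -/
noncomputable def scale [CharZero 𝕜] : G →ₗ⁅𝕜⁆ G :=
  { 𝒵.scaleLinear with
    map_lie' := fun {x y} => by
      change 𝒵.scaleLinear ⁅x, y⁆ = ⁅𝒵.scaleLinear x, 𝒵.scaleLinear y⁆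
      induction x using 𝒵.induction_homogeneous with
      | zero => simp
      | add a b ha hb => simp only [add_lie, map_add, ha, hb]
      | mem i a ha =>
        induction y using 𝒵.induction_homogeneous with
        | zero => simp
        | add c d hc hd => simp only [lie_add, map_add, hc, hd]
        | mem j c hc =>
          rw [𝒵.scaleLinear_of_mem ha, 𝒵.scaleLinear_of_mem hc,
            𝒵.scaleLinear_of_mem (𝒵.lie_mem ha hc), smul_lie, lie_smul, smul_smul,
            zpow_add₀ two_ne_zero] }

lemma scale_of_mem [CharZero 𝕜] {i : ℤ} {x : G} (hx : x ∈ 𝒵.comp i) :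
    𝒵.scale x = (2 : 𝕜) ^ i • x :=
  𝒵.scaleLinear_of_mem hx

/-- The automorphism of `U(G)` induced by `scale`. -/
noncomputable def scaleU [CharZero 𝕜] :
    UniversalEnvelopingAlgebra 𝕜 G →ₐ[𝕜] UniversalEnvelopingAlgebra 𝕜 G :=
  UniversalEnvelopingAlgebra.lift 𝕜 ((UniversalEnvelopingAlgebra.ι 𝕜).comp 𝒵.scale)

lemma scaleU_ι [CharZero 𝕜] (x : G) :
    𝒵.scaleU (UniversalEnvelopingAlgebra.ι 𝕜 x) = UniversalEnvelopingAlgebra.ι 𝕜 (𝒵.scale x) :=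
  UniversalEnvelopingAlgebra.lift_ι_apply 𝕜 _ x

lemma scaleU_of_mem [CharZero 𝕜] {i : ℤ} {u : UniversalEnvelopingAlgebra 𝕜 G}
    (hu : u ∈ 𝒵.envelopingComp i) : 𝒵.scaleU u = (2 : 𝕜) ^ i • u := by
  induction hu using Submodule.span_induction with
  | zero => simp
  | add a b _ _ ha hb => rw [map_add, ha, hb, smul_add]
  | smul c a _ ha => rw [map_smul, ha, smul_comm]
  | mem u hu =>
    obtain ⟨l, hl, rfl, rfl⟩ := hu
    induction l with
    | nil => simp
    | cons a l ih =>
      have h := ih fun p hp => hl p (List.mem_cons_of_mem _ hp)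
      simp only [List.map_cons, List.prod_cons, List.sum_cons, map_mul]
      rw [h, scaleU_ι, 𝒵.scale_of_mem (hl a (by simp)), map_smul, zpow_add₀ two_ne_zero,
        smul_mul_smul_comm]

lemma mul_mem_envelopingComp {i j : ℤ} {u u' : UniversalEnvelopingAlgebra 𝕜 G}
    (hu : u ∈ 𝒵.envelopingComp i) (hu' : u' ∈ 𝒵.envelopingComp j) :
    u * u' ∈ 𝒵.envelopingComp (i + j) := by
  have h : 𝒵.envelopingComp i * 𝒵.envelopingComp j ≤ 𝒵.envelopingComp (i + j) := by
    rw [envelopingComp, envelopingComp, Submodule.span_mul_span, Submodule.span_le]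
    rintro _ ⟨_, ⟨l, hl, rfl, rfl⟩, _, ⟨l', hl', rfl, rfl⟩, rfl⟩
    refine Submodule.subset_span ⟨l ++ l', fun p hp => ?_, by simp, by simp⟩
    exact (List.mem_append.1 hp).elim (hl p) (hl' p)
  exact h (Submodule.mul_mem_mul hu hu')

lemma one_mem_envelopingComp : (1 : UniversalEnvelopingAlgebra 𝕜 G) ∈ 𝒵.envelopingComp 0 :=
  Submodule.subset_span ⟨[], by simp, by simp, by simp⟩

lemma ι_mem_envelopingComp {i : ℤ} {x : G} (hx : x ∈ 𝒵.comp i) :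
    UniversalEnvelopingAlgebra.ι 𝕜 x ∈ 𝒵.envelopingComp i :=
  Submodule.subset_span ⟨[(i, x)], by simpa using hx, by simp, by simp⟩

end LieGrading

/-- `U(G)` is generated by `G`. -/
lemma UniversalEnvelopingAlgebra.subalgebra_eq_top
    (S : Subalgebra 𝕜 (UniversalEnvelopingAlgebra 𝕜 G))
    (hS : ∀ x : G, UniversalEnvelopingAlgebra.ι 𝕜 x ∈ S) : S = ⊤ := by
  let f : G →ₗ⁅𝕜⁆ S :=
    { ((UniversalEnvelopingAlgebra.ι 𝕜 : G →ₗ⁅𝕜⁆ _) :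
        G →ₗ[𝕜] UniversalEnvelopingAlgebra 𝕜 G).codRestrict S.toSubmodule hS with
      map_lie' := fun {x y} => Subtype.ext (LieHom.map_lie _ x y) }
  -- By the universal property, lifting `G → S` and then including `S` is the identity, so the
  -- inclusion is onto.
  have h : S.val.comp (UniversalEnvelopingAlgebra.lift 𝕜 f) = AlgHom.id 𝕜 _ := by
    apply UniversalEnvelopingAlgebra.hom_ext
    apply LieHom.ext
    intro x
    change ((UniversalEnvelopingAlgebra.lift 𝕜 f (UniversalEnvelopingAlgebra.ι 𝕜 x) : S) :
      UniversalEnvelopingAlgebra 𝕜 G) = UniversalEnvelopingAlgebra.ι 𝕜 x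
    rw [UniversalEnvelopingAlgebra.lift_ι_apply]
    rfl
  refine eq_top_iff.2 fun u _ => ?_
  have hu : ((UniversalEnvelopingAlgebra.lift 𝕜 f u : S) : UniversalEnvelopingAlgebra 𝕜 G) = u :=
    AlgHom.congr_fun h u
  rw [← hu]
  exact Subtype.prop _

@[elab_as_elim]
lemma UniversalEnvelopingAlgebra.induction {p : UniversalEnvelopingAlgebra 𝕜 G → Prop}
    (u : UniversalEnvelopingAlgebra 𝕜 G) (algebraMap : ∀ c : 𝕜, p (algebraMap 𝕜 _ c))
    (ι : ∀ x : G, p (UniversalEnvelopingAlgebra.ι 𝕜 x)) (add : ∀ a b, p a → p b → p (a + b))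
    (mul : ∀ a b, p a → p b → p (a * b)) : p u := by
  let S : Subalgebra 𝕜 (UniversalEnvelopingAlgebra 𝕜 G) :=
    { carrier := {u | p u}
      mul_mem' := fun {a b} ha hb => mul a b ha hb
      add_mem' := fun {a b} ha hb => add a b ha hb
      algebraMap_mem' := algebraMap }
  have h : u ∈ S := by
    rw [UniversalEnvelopingAlgebra.subalgebra_eq_top S ι]
    trivial
  exact h

lemma LieGrading.iSup_envelopingComp (𝒵 : LieGrading 𝕜 G ℤ) :
    ⨆ i, 𝒵.envelopingComp i = ⊤ := by
  refine eq_top_iff.2 fun u _ => ?_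
  induction u using UniversalEnvelopingAlgebra.induction with
  | algebraMap c =>
    rw [Algebra.algebraMap_eq_smul_one]
    exact Submodule.smul_mem _ _ (Submodule.mem_iSup_of_mem 0 𝒵.one_mem_envelopingComp)
  | ι x =>
    induction x using 𝒵.induction_homogeneous with
    | zero => simp
    | add y z hy hz => rw [map_add]; exact add_mem (hy trivial) (hz trivial)
    | mem i y hy => exact Submodule.mem_iSup_of_mem i (𝒵.ι_mem_envelopingComp hy)
  | add a b ha hb => exact add_mem (ha trivial) (hb trivial)
  | mul a b ha hb =>
    have hab := Submodule.mul_mem_mul (ha trivial) (hb trivial)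
    have hle : (⨆ i, 𝒵.envelopingComp i) * ⨆ j, 𝒵.envelopingComp j ≤
        ⨆ i, 𝒵.envelopingComp i := by
      rw [Submodule.iSup_mul]
      refine iSup_le fun i => ?_
      rw [Submodule.mul_iSup]
      exact iSup_le fun j => (Submodule.mul_le.2 fun x hx y hy =>
        𝒵.mul_mem_envelopingComp hx hy).trans (le_iSup 𝒵.envelopingComp (i + j))
    exact hle hab

section Action

variable {M : Type*} [AddCommGroup M] [Module 𝕜 M] [Module (UniversalEnvelopingAlgebra 𝕜 G) M]
  [IsScalarTower 𝕜 (UniversalEnvelopingAlgebra 𝕜 G) M]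

/-- The action of `G` on a `U(G)`-module. -/
noncomputable def envelopingAction (𝕜 G M : Type*) [Field 𝕜] [LieRing G] [LieAlgebra 𝕜 G]
    [AddCommGroup M] [Module 𝕜 M] [Module (UniversalEnvelopingAlgebra 𝕜 G) M]
    [IsScalarTower 𝕜 (UniversalEnvelopingAlgebra 𝕜 G) M] : G →ₗ⁅𝕜⁆ Module.End 𝕜 M :=
  ((Algebra.lsmul 𝕜 𝕜 M : UniversalEnvelopingAlgebra 𝕜 G →ₐ[𝕜] Module.End 𝕜 M) :
    UniversalEnvelopingAlgebra 𝕜 G →ₗ⁅𝕜⁆ Module.End 𝕜 M).comp (UniversalEnvelopingAlgebra.ι 𝕜)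

lemma envelopingAction_apply (x : G) (m : M) :
    envelopingAction 𝕜 G M x m = UniversalEnvelopingAlgebra.ι 𝕜 x • m := rfl

/-- Let `G` be spanned by `A` and `B`, and let `B` preserve `W`.  Any subspace containing `W` and
preserved by `A` contains a `G`-submodule containing `W`. -/
lemma exists_submodule_between {A B : Set G} (hAB : Submodule.span 𝕜 (A ∪ B) = ⊤)
    {W P : Submodule 𝕜 M} (hWP : W ≤ P)
    (hB : ∀ x ∈ B, ∀ m ∈ W, UniversalEnvelopingAlgebra.ι 𝕜 x • m ∈ W)
    (hA : ∀ x ∈ A, ∀ m ∈ P, UniversalEnvelopingAlgebra.ι 𝕜 x • m ∈ P) :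
    ∃ N : Submodule (UniversalEnvelopingAlgebra 𝕜 G) M,
      W ≤ N.restrictScalars 𝕜 ∧ N.restrictScalars 𝕜 ≤ P := by
  let 𝒮 : Set (Submodule 𝕜 M) :=
    {Q | W ≤ Q ∧ ∀ x ∈ A, ∀ m ∈ Q, UniversalEnvelopingAlgebra.ι 𝕜 x • m ∈ Q}
  let S : Submodule 𝕜 M := sInf 𝒮
  have hWS : W ≤ S := le_sInf fun Q hQ => hQ.1
  have hAS : ∀ x ∈ A, ∀ m ∈ S, UniversalEnvelopingAlgebra.ι 𝕜 x • m ∈ S := by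
    intro x hx m hm
    rw [Submodule.mem_sInf] at hm ⊢
    exact fun Q hQ => hQ.2 x hx m (hm Q hQ)
  -- `S` is the smallest `A`-stable subspace containing `W`. Showing that `T`, the vectors of `S`
  -- which all of `G` sends into `S`, is also `A`-stable and contains `W` gives `S ≤ T`, so `S` is
  -- `G`-stable. This replaces a PBW factorization of `U(G)`.
  let T : Submodule 𝕜 M :=
    S ⊓ ⨅ x : G, S.comap (envelopingAction 𝕜 G M x)
  have hmemT : ∀ m, m ∈ T ↔ m ∈ S ∧ ∀ x : G, UniversalEnvelopingAlgebra.ι 𝕜 x • m ∈ S := by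
    intro m
    simp only [T, Submodule.mem_inf, Submodule.mem_iInf, Submodule.mem_comap,
      envelopingAction_apply]
  have hST : S ≤ T := by
    refine sInf_le ⟨fun m hm => (hmemT m).2 ⟨hWS hm, fun x => ?_⟩, fun y hy m hm => ?_⟩
    · have hx : x ∈ Submodule.span 𝕜 (A ∪ B) := by
        rw [hAB]
        trivial
      induction hx using Submodule.span_induction with
      | mem x hx => exact hx.elim (fun h => hAS x h m (hWS hm)) fun h => hWS (hB x h m hm)
      | zero => simp
      | add a b _ _ ha hb => rw [map_add, add_smul]; exact add_mem ha hb
      | smul c a _ ha => rw [map_smul, smul_assoc]; exact S.smul_mem c ha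
    · obtain ⟨hmS, hmG⟩ := (hmemT m).1 hm
      refine (hmemT _).2 ⟨hmG y, fun x => ?_⟩
      have h : UniversalEnvelopingAlgebra.ι 𝕜 x • UniversalEnvelopingAlgebra.ι 𝕜 y • m =
          UniversalEnvelopingAlgebra.ι 𝕜 ⁅x, y⁆ • m +
            UniversalEnvelopingAlgebra.ι 𝕜 y • UniversalEnvelopingAlgebra.ι 𝕜 x • m := by
        rw [LieHom.map_lie, LieRing.of_associative_ring_bracket, sub_smul, mul_smul, mul_smul]
        abel
      rw [h]
      exact add_mem (hmG _) (hAS y hy _ (hmG x))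
  refine ⟨{ S with smul_mem' := fun u m hm => ?_ }, hWS, sInf_le ⟨hWP, hA⟩⟩
  change m ∈ S at hm
  change u • m ∈ S
  induction u using UniversalEnvelopingAlgebra.induction generalizing m with
  | algebraMap c => rw [algebraMap_smul]; exact S.smul_mem c hm
  | ι x => exact ((hmemT m).1 (hST hm)).2 x
  | add a b ha hb => rw [add_smul]; exact add_mem (ha m hm) (hb m hm)
  | mul a b ha hb => rw [mul_smul]; exact ha _ (hb m hm)

/-- Subspaces on which a `scaleU`-semilinear map acts by the scalars `2 ^ i` are independent. -/
lemma LieGrading.iSupIndep_of_scale [CharZero 𝕜] (𝒵 : LieGrading 𝕜 G ℤ)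
    (φ : M →ₛₗ[(𝒵.scaleU : UniversalEnvelopingAlgebra 𝕜 G →+* UniversalEnvelopingAlgebra 𝕜 G)] M)
    {ℳ : ℤ → Submodule 𝕜 M} (h : ∀ i, ∀ m ∈ ℳ i, φ m = (2 : 𝕜) ^ i • m) : iSupIndep ℳ := by
  let φ' : Module.End 𝕜 M :=
    { toFun := φ
      map_add' := map_add φ
      map_smul' := fun c m => by
        have hc : φ (algebraMap 𝕜 (UniversalEnvelopingAlgebra 𝕜 G) c • m) =
            algebraMap 𝕜 (UniversalEnvelopingAlgebra 𝕜 G) c • φ m := by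
          rw [LinearMap.map_smulₛₗ]
          simp
        simpa using hc }
  -- Characteristic zero makes the scalars `2 ^ i` pairwise distinct, by comparison with `ℚ`.
  have hinj : Function.Injective fun i : ℤ => (2 : 𝕜) ^ i := by
    intro i j hij
    have h2 : ((2 : ℚ) ^ i : ℚ) = 2 ^ j := by
      have : (((2 : ℚ) ^ i : ℚ) : 𝕜) = (((2 : ℚ) ^ j : ℚ) : 𝕜) := by
        push_cast
        exact hij
      exact_mod_cast this
    exact zpow_right_injective₀ (by norm_num) (by norm_num) h2
  exact (φ'.eigenspaces_iSupIndep.comp hinj).mono fun i m hm =>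
    Module.End.mem_eigenspace_iff.2 (h i m hm)

end Action

/-- Subspaces of the members of an independent family which span everything are equal to the
members of that family. -/
lemma eq_of_le_of_iSupIndep {M : Type*} [AddCommGroup M] [Module 𝕜 M]
    {ℳ 𝒩 : ℤ → Submodule 𝕜 M} (hℳ : iSupIndep ℳ) (hle : ∀ i, 𝒩 i ≤ ℳ i)
    (htop : ⨆ i, 𝒩 i = ⊤) (i : ℤ) : 𝒩 i = ℳ i := by
  refine le_antisymm (hle i) fun m hm => ?_
  have h : m ∈ 𝒩 i ⊔ ⨆ (j) (_ : j ≠ i), 𝒩 j := by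
    rw [← iSup_split_single, htop]
    trivial
  obtain ⟨a, ha, b, hb, rfl⟩ := Submodule.mem_sup.1 h
  have hb' : b ∈ ⨆ (j) (_ : j ≠ i), ℳ j := iSup₂_mono (fun j _ => hle j) hb
  have hb'' : b ∈ ℳ i := by simpa using sub_mem hm (hle i ha)
  have : b = 0 := Submodule.disjoint_def.1 (hℳ i) b hb'' hb'
  simpa [this] using ha

end Gradings

lemma iSup_map_eq_top {𝕜 M N ι : Type*} [Field 𝕜] [AddCommGroup M] [Module 𝕜 M] [AddCommGroup N]
    [Module 𝕜 N] {ℳ : ι → Submodule 𝕜 M} (f : M →ₗ[𝕜] N) (hf : Function.Surjective f)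
    (h : ⨆ i, ℳ i = ⊤) : ⨆ i, (ℳ i).map f = ⊤ := by
  rw [← Submodule.map_iSup, h, Submodule.map_top, LinearMap.range_eq_top.2 hf]

/-! ### The gradings of the induced module and of its quotient by the radical. -/

section GeneralizedVermaModule

attribute [local instance] LieRing.ofAssociativeRing

variable {𝕜 G : Type*} [Field 𝕜] [LieRing G] [LieAlgebra 𝕜 G] (𝒵 : LieGrading 𝕜 G ℤ)
  (V : Type*) [AddCommGroup V] [Module 𝕜 V] [LieRingModule 𝒵.zeroPart V]
  [LieModule 𝕜 𝒵.zeroPart V]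

lemma LieGrading.mem_nonnegPart {i : ℤ} (hi : 0 ≤ i) {x : G} (hx : x ∈ 𝒵.comp i) :
    x ∈ 𝒵.nonnegPart :=
  Submodule.mem_iSup_of_mem (p := fun i : {i : ℤ // 0 ≤ i} => 𝒵.comp i) ⟨i, hi⟩ hx

lemma toZeroPart_of_mem {x : G} (hx : x ∈ 𝒵.comp 0) :
    𝒵.toZeroPart ⟨x, 𝒵.mem_nonnegPart le_rfl hx⟩ = ⟨x, hx⟩ :=
  Subtype.ext (congrArg Subtype.val (𝒵.proj_of_mem hx))

lemma toZeroPart_of_mem_pos {i : ℤ} (hi : 0 < i) {x : G} (hx : x ∈ 𝒵.comp i) :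
    𝒵.toZeroPart ⟨x, 𝒵.mem_nonnegPart hi.le hx⟩ = 0 :=
  Subtype.ext (congrArg Subtype.val (𝒵.proj_of_mem_ne hx hi.ne'))

/-- The scaling is trivial in degree zero, and the projection forgets all other degrees.
Consequently the relations defining `M̃(V)` are carried to relations of the same kind. -/
lemma scale_toZeroPart [CharZero 𝕜] (x : 𝒵.nonnegPart) :
    ∃ h : 𝒵.scale (x : G) ∈ 𝒵.nonnegPart, 𝒵.toZeroPart ⟨𝒵.scale x, h⟩ = 𝒵.toZeroPart x := by
  obtain ⟨x, hx⟩ := x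
  change x ∈ (⨆ i : {i : ℤ // 0 ≤ i}, 𝒵.comp i) at hx
  induction hx using Submodule.iSup_induction' with
  | zero =>
    refine ⟨by simp, ?_⟩
    congr 1
    exact Subtype.ext (map_zero 𝒵.scale)
  | add a b ha' hb' ha hb =>
    obtain ⟨ha, ha₁⟩ := ha
    obtain ⟨hb, hb₁⟩ := hb
    refine ⟨by simpa using add_mem ha hb, ?_⟩
    have h₁ := map_add 𝒵.toZeroPart (⟨a, ha'⟩ : 𝒵.nonnegPart) ⟨b, hb'⟩
    have h₂ := map_add 𝒵.toZeroPart (⟨_, ha⟩ : 𝒵.nonnegPart) ⟨_, hb⟩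
    rw [ha₁, hb₁, ← h₁] at h₂
    refine Eq.trans ?_ h₂
    congr 1
    exact Subtype.ext (map_add 𝒵.scale a b)
  | mem i a ha =>
    have hs : 𝒵.scale a ∈ 𝒵.comp i := by
      rw [𝒵.scale_of_mem ha]
      exact Submodule.smul_mem _ _ ha
    refine ⟨𝒵.mem_nonnegPart i.2 hs, ?_⟩
    obtain ⟨i, hi⟩ := i
    rcases hi.eq_or_lt with rfl | hi
    · rw [toZeroPart_of_mem 𝒵 hs]
      refine Eq.trans ?_ (toZeroPart_of_mem 𝒵 ha).symm
      exact Subtype.ext (by simpa using 𝒵.scale_of_mem ha)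
    · rw [toZeroPart_of_mem_pos 𝒵 hi hs]
      exact (toZeroPart_of_mem_pos 𝒵 hi ha).symm

variable {V}

lemma ι_smul_toMTilde (x : 𝒵.nonnegPart) (v : V) :
    UniversalEnvelopingAlgebra.ι 𝕜 (x : G) • toMTilde 𝒵 V v =
      toMTilde 𝒵 V (inflatedRep 𝒵 V x v) := by
  refine (Submodule.Quotient.eq _).2 (Submodule.subset_span ⟨1, x, v, ?_⟩)
  simp [TensorProduct.smul_tmul']

lemma ι_smul_toMTilde_zero {x : G} (hx : x ∈ 𝒵.comp 0) (v : V) :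
    UniversalEnvelopingAlgebra.ι 𝕜 x • toMTilde 𝒵 V v =
      toMTilde 𝒵 V ⁅(⟨x, hx⟩ : 𝒵.zeroPart), v⁆ := by
  rw [← toZeroPart_of_mem 𝒵 hx]
  exact ι_smul_toMTilde 𝒵 ⟨x, 𝒵.mem_nonnegPart le_rfl hx⟩ v

lemma ι_smul_toMTilde_pos {i : ℤ} (hi : 0 < i) {x : G} (hx : x ∈ 𝒵.comp i) (v : V) :
    UniversalEnvelopingAlgebra.ι 𝕜 x • toMTilde 𝒵 V v = 0 := by
  refine (ι_smul_toMTilde 𝒵 ⟨x, 𝒵.mem_nonnegPart hi.le hx⟩ v).trans ?_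
  have h : inflatedRep 𝒵 V ⟨x, 𝒵.mem_nonnegPart hi.le hx⟩ v =
      ⁅𝒵.toZeroPart ⟨x, 𝒵.mem_nonnegPart hi.le hx⟩, v⁆ := rfl
  rw [h, toZeroPart_of_mem_pos 𝒵 hi hx, zero_lie, map_zero]

lemma smul_mem_MTildeComp {i j : ℤ} {u : UniversalEnvelopingAlgebra 𝕜 G}
    (hu : u ∈ 𝒵.envelopingComp i) {m : MTilde 𝒵 V} (hm : m ∈ MTildeComp 𝒵 V j) :
    u • m ∈ MTildeComp 𝒵 V (i + j) := by
  induction hm using Submodule.span_induction with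
  | mem m hm =>
    obtain ⟨u', hu', v, rfl⟩ := hm
    rw [← mul_smul]
    exact Submodule.subset_span ⟨_, 𝒵.mul_mem_envelopingComp hu hu', v, rfl⟩
  | zero => simp
  | add a b _ _ ha hb => rw [smul_add]; exact add_mem ha hb
  | smul c a _ ha => rw [smul_comm]; exact Submodule.smul_mem _ c ha

lemma ι_smul_mem_MTildeComp {i j : ℤ} {x : G} (hx : x ∈ 𝒵.comp i) {m : MTilde 𝒵 V}
    (hm : m ∈ MTildeComp 𝒵 V j) :
    UniversalEnvelopingAlgebra.ι 𝕜 x • m ∈ MTildeComp 𝒵 V (i + j) :=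
  smul_mem_MTildeComp 𝒵 (𝒵.ι_mem_envelopingComp hx) hm

lemma toMTilde_mem_MTildeComp (v : V) : toMTilde 𝒵 V v ∈ MTildeComp 𝒵 V 0 :=
  Submodule.subset_span ⟨1, 𝒵.one_mem_envelopingComp, v, (one_smul _ _).symm⟩

/-- A `G`-submodule of `M̃(V)` which contains `V` is the whole of `M̃(V)`. -/
lemma eq_top_of_range_toMTilde_le
    {N : Submodule (UniversalEnvelopingAlgebra 𝕜 G) (MTilde 𝒵 V)}
    (h : LinearMap.range (toMTilde 𝒵 V) ≤ N.restrictScalars 𝕜) : N = ⊤ := by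
  refine eq_top_iff.2 fun m _ => ?_
  obtain ⟨z, rfl⟩ := Submodule.mkQ_surjective _ m
  induction z using TensorProduct.induction_on with
  | zero => simp
  | add a b ha hb => rw [map_add]; exact add_mem (ha trivial) (hb trivial)
  | tmul u v =>
    have hv : toMTilde 𝒵 V v ∈ N := h ⟨v, rfl⟩
    have huv := N.smul_mem u hv
    convert huv using 1
    rw [show u ⊗ₜ[𝕜] v = u • ((1 : UniversalEnvelopingAlgebra 𝕜 G) ⊗ₜ[𝕜] v) by
      simp [TensorProduct.smul_tmul'], map_smul]
    rfl

/-- The part of a `G`-submodule of `M̃(V)` which is spanned by its homogeneous elements. -/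
noncomputable def homogeneousPart (N : Submodule (UniversalEnvelopingAlgebra 𝕜 G) (MTilde 𝒵 V)) :
    Submodule (UniversalEnvelopingAlgebra 𝕜 G) (MTilde 𝒵 V) :=
  { (⨆ i : ℤ, N.restrictScalars 𝕜 ⊓ MTildeComp 𝒵 V i) with
    smul_mem' := fun u m hm => by
      change u • m ∈ (⨆ i : ℤ, N.restrictScalars 𝕜 ⊓ MTildeComp 𝒵 V i)
      change m ∈ (⨆ i : ℤ, N.restrictScalars 𝕜 ⊓ MTildeComp 𝒵 V i) at hm
      have hu : u ∈ ⨆ i, 𝒵.envelopingComp i := by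
        rw [𝒵.iSup_envelopingComp]
        trivial
      induction hm using Submodule.iSup_induction' with
      | zero => simp
      | add a b _ _ ha hb => rw [smul_add]; exact add_mem ha hb
      | mem j m hm =>
        induction hu using Submodule.iSup_induction' with
        | zero => simp
        | add a b _ _ ha hb => rw [add_smul]; exact add_mem ha hb
        | mem i u hu =>
          exact Submodule.mem_iSup_of_mem (i + j)
            ⟨N.smul_mem u hm.1, smul_mem_MTildeComp 𝒵 hu hm.2⟩ }

lemma mem_homogeneousPart {N : Submodule (UniversalEnvelopingAlgebra 𝕜 G) (MTilde 𝒵 V)} {i : ℤ}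
    {m : MTilde 𝒵 V} (hm : m ∈ N) (hmi : m ∈ MTildeComp 𝒵 V i) : m ∈ homogeneousPart 𝒵 N :=
  Submodule.mem_iSup_of_mem (p := fun i => N.restrictScalars 𝕜 ⊓ MTildeComp 𝒵 V i) i ⟨hm, hmi⟩

lemma isGradedSubmodule_iff {N : Submodule (UniversalEnvelopingAlgebra 𝕜 G) (MTilde 𝒵 V)} :
    IsGradedSubmodule 𝒵 V N ↔ N ≤ homogeneousPart 𝒵 N := by
  refine ⟨fun h m hm => ?_, fun h => le_antisymm h (iSup_le fun i => inf_le_left)⟩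
  have hm' : m ∈ N.restrictScalars 𝕜 := hm
  rw [h] at hm'
  exact hm'

lemma homogeneousPart_mono {N N' : Submodule (UniversalEnvelopingAlgebra 𝕜 G) (MTilde 𝒵 V)}
    (h : N ≤ N') : homogeneousPart 𝒵 N ≤ homogeneousPart 𝒵 N' :=
  fun _ hm => (iSup_mono fun _ => inf_le_inf_right _ h :
    (⨆ i : ℤ, N.restrictScalars 𝕜 ⊓ MTildeComp 𝒵 V i) ≤
      ⨆ i : ℤ, N'.restrictScalars 𝕜 ⊓ MTildeComp 𝒵 V i) hm

/-- Each graded submodule in the defining sum lies in its own homogeneous part, hence in that of the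
sum. -/
lemma isGradedSubmodule_MTildeRad : IsGradedSubmodule 𝒵 V (MTildeRad 𝒵 V) := by
  rw [isGradedSubmodule_iff]
  refine sSup_le fun N hN => ((isGradedSubmodule_iff 𝒵).1 hN.1).trans ?_
  exact homogeneousPart_mono 𝒵 (le_sSup hN)

lemma isGradedSubmodule_span_singleton {i : ℤ} {m : MTilde 𝒵 V} (hm : m ∈ MTildeComp 𝒵 V i) :
    IsGradedSubmodule 𝒵 V (Submodule.span _ {m}) := by
  rw [isGradedSubmodule_iff, Submodule.span_singleton_le_iff_mem]
  exact mem_homogeneousPart 𝒵 (Submodule.mem_span_singleton_self m) hm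

/-- The sum of the components is stable under `U(G)` and contains `V`, which generates `M̃(V)`. -/
lemma iSup_MTildeComp : ⨆ i, MTildeComp 𝒵 V i = ⊤ := by
  have h : homogeneousPart 𝒵 (⊤ : Submodule (UniversalEnvelopingAlgebra 𝕜 G) (MTilde 𝒵 V)) = ⊤ := by
    refine eq_top_of_range_toMTilde_le 𝒵 ?_
    rintro _ ⟨v, rfl⟩
    exact mem_homogeneousPart 𝒵 trivial (toMTilde_mem_MTildeComp 𝒵 v)
  refine eq_top_iff.2 fun m _ => ?_
  have hm : m ∈ homogeneousPart 𝒵 (⊤ : Submodule _ (MTilde 𝒵 V)) := by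
    rw [h]
    trivial
  exact (iSup_mono fun i => inf_le_right :
    (⨆ i : ℤ, (⊤ : Submodule (UniversalEnvelopingAlgebra 𝕜 G) (MTilde 𝒵 V)).restrictScalars 𝕜 ⊓
      MTildeComp 𝒵 V i) ≤ _) hm

variable [CharZero 𝕜]

variable (V) in
/-- The `scaleU`-semilinear map `U(G) ⊗ V → U(G) ⊗ V` induced by `scaleU`. -/
noncomputable def scaleTensor :
    (UniversalEnvelopingAlgebra 𝕜 G ⊗[𝕜] V) →ₛₗ[(𝒵.scaleU :
      UniversalEnvelopingAlgebra 𝕜 G →+* UniversalEnvelopingAlgebra 𝕜 G)]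
      (UniversalEnvelopingAlgebra 𝕜 G ⊗[𝕜] V) :=
  { LinearMap.rTensor V 𝒵.scaleU.toLinearMap with
    map_smul' := fun u z => by
      change LinearMap.rTensor V 𝒵.scaleU.toLinearMap (u • z) =
        𝒵.scaleU u • LinearMap.rTensor V 𝒵.scaleU.toLinearMap z
      induction z using TensorProduct.induction_on with
      | zero => simp
      | add a b ha hb => rw [smul_add, map_add, ha, hb, map_add, smul_add]
      | tmul a v => simp [TensorProduct.smul_tmul'] }

omit [LieRingModule 𝒵.zeroPart V] [LieModule 𝕜 𝒵.zeroPart V] in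
lemma scaleTensor_tmul (u : UniversalEnvelopingAlgebra 𝕜 G) (v : V) :
    scaleTensor 𝒵 V (u ⊗ₜ v) = 𝒵.scaleU u ⊗ₜ v := rfl

variable (V) in
lemma inducedRelations_le_comap_scaleTensor :
    inducedRelations 𝒵.nonnegPart (inflatedRep 𝒵 V) ≤
      (inducedRelations 𝒵.nonnegPart (inflatedRep 𝒵 V)).comap (scaleTensor 𝒵 V) := by
  refine Submodule.span_le.2 ?_
  rintro _ ⟨u, x, v, rfl⟩
  obtain ⟨h, hx⟩ := scale_toZeroPart 𝒵 x
  refine Submodule.subset_span ⟨𝒵.scaleU u, ⟨𝒵.scale x, h⟩, v, ?_⟩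
  have hρ : inflatedRep 𝒵 V ⟨𝒵.scale x, h⟩ = inflatedRep 𝒵 V x :=
    congrArg (LieModule.toEnd 𝕜 𝒵.zeroPart V) hx
  rw [map_sub, scaleTensor_tmul, scaleTensor_tmul, map_mul, 𝒵.scaleU_ι, hρ]

variable (V) in
/-- The `scaleU`-semilinear map on `M̃(V)` which acts as `2 ^ i` on `M̃(V)^(i)`. -/
noncomputable def scaleMTilde : MTilde 𝒵 V →ₛₗ[(𝒵.scaleU :
    UniversalEnvelopingAlgebra 𝕜 G →+* UniversalEnvelopingAlgebra 𝕜 G)] MTilde 𝒵 V :=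
  Submodule.mapQ _ _ (scaleTensor 𝒵 V) (inducedRelations_le_comap_scaleTensor 𝒵 V)

lemma scaleMTilde_of_mem {i : ℤ} {m : MTilde 𝒵 V} (hm : m ∈ MTildeComp 𝒵 V i) :
    scaleMTilde 𝒵 V m = (2 : 𝕜) ^ i • m := by
  induction hm using Submodule.span_induction with
  | zero => simp
  | add a b _ _ ha hb => rw [map_add, ha, hb, smul_add]
  | smul c a _ ha =>
    rw [← algebraMap_smul (UniversalEnvelopingAlgebra 𝕜 G) c a, LinearMap.map_smulₛₗ, ha]
    simp [smul_comm c]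
  | mem m hm =>
    obtain ⟨u, hu, v, rfl⟩ := hm
    have h₁ : scaleMTilde 𝒵 V (toMTilde 𝒵 V v) = toMTilde 𝒵 V v := by
      have h : scaleTensor 𝒵 V (1 ⊗ₜ v) = 1 ⊗ₜ v := by rw [scaleTensor_tmul, map_one]
      exact congrArg (Submodule.mkQ (inducedRelations 𝒵.nonnegPart (inflatedRep 𝒵 V))) h
    rw [LinearMap.map_smulₛₗ, h₁, RingHom.coe_coe, 𝒵.scaleU_of_mem hu, smul_assoc]

lemma iSupIndep_MTildeComp : iSupIndep (MTildeComp 𝒵 V) :=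
  𝒵.iSupIndep_of_scale (scaleMTilde 𝒵 V) fun _ _ hm => scaleMTilde_of_mem 𝒵 hm

lemma IsGradedSubmodule.le_comap_scaleMTilde
    {N : Submodule (UniversalEnvelopingAlgebra 𝕜 G) (MTilde 𝒵 V)}
    (hN : IsGradedSubmodule 𝒵 V N) : N ≤ N.comap (scaleMTilde 𝒵 V) := by
  intro m hm
  have hm' : m ∈ N.restrictScalars 𝕜 := hm
  rw [hN] at hm'
  rw [Submodule.mem_comap]
  clear hm
  induction hm' using Submodule.iSup_induction' with
  | zero => simp
  | add a b _ _ ha hb => rw [map_add]; exact add_mem ha hb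
  | mem i m hm =>
    rw [scaleMTilde_of_mem 𝒵 hm.2]
    exact (N.restrictScalars 𝕜).smul_mem _ hm.1

/-- The radical is graded, hence stable under the scaling, which therefore descends to `M(V)` with
the same eigenvalues. -/
lemma iSupIndep_MQuotComp : iSupIndep (MQuotComp 𝒵 V) := by
  refine 𝒵.iSupIndep_of_scale (Submodule.mapQ _ _ (scaleMTilde 𝒵 V)
    (IsGradedSubmodule.le_comap_scaleMTilde 𝒵 (isGradedSubmodule_MTildeRad 𝒵))) ?_
  rintro i _ ⟨m, hm, rfl⟩
  exact (congrArg (MTildeRad 𝒵 V).mkQ (scaleMTilde_of_mem 𝒵 hm)).trans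
    (((MTildeRad 𝒵 V).mkQ.restrictScalars 𝕜).map_smul _ _)

omit [CharZero 𝕜]

variable (V) in
/-- The projection `M̃(V) → M(V)`. -/
noncomputable def toMQuot : MTilde 𝒵 V →ₗ[𝕜] MQuot 𝒵 V :=
  (MTildeRad 𝒵 V).mkQ.restrictScalars 𝕜

lemma toMQuot_surjective : Function.Surjective (toMQuot 𝒵 V) :=
  fun m => Submodule.mkQ_surjective (MTildeRad 𝒵 V) m

lemma toMQuot_smul (u : UniversalEnvelopingAlgebra 𝕜 G) (m : MTilde 𝒵 V) :
    toMQuot 𝒵 V (u • m) = u • toMQuot 𝒵 V m := rfl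

lemma toMQuot_eq_zero {m : MTilde 𝒵 V} : toMQuot 𝒵 V m = 0 ↔ m ∈ MTildeRad 𝒵 V :=
  Submodule.Quotient.mk_eq_zero _

lemma MQuotComp_eq_map (i : ℤ) : MQuotComp 𝒵 V i = (MTildeComp 𝒵 V i).map (toMQuot 𝒵 V) := rfl

/-- `M(V)` is a graded `G`-module. -/
theorem isModuleGrading_MQuotComp [CharZero 𝕜] : IsModuleGrading 𝒵 (MQuotComp 𝒵 V) where
  isInternal := by
    rw [DirectSum.isInternal_submodule_iff_iSupIndep_and_iSup_eq_top]
    refine ⟨iSupIndep_MQuotComp 𝒵, ?_⟩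
    exact iSup_map_eq_top (toMQuot 𝒵 V) (toMQuot_surjective 𝒵) (iSup_MTildeComp 𝒵)
  smul_mem := by
    rintro i j x _ hx ⟨m, hm, rfl⟩
    exact ⟨UniversalEnvelopingAlgebra.ι 𝕜 x • m, ι_smul_mem_MTildeComp 𝒵 hx hm, rfl⟩

end GeneralizedVermaModule

/-! ### Spanning by words of negative letters, the radical, and finite-dimensionality. -/

section Finiteness

attribute [local instance] LieRing.ofAssociativeRing

/-- The word `k₁ ⋯ kₚ` whose letters depend on independent variables `α₁, …, αₚ`. -/
def freeWord {K : Type*} (n : ℕ) {p : ℕ} (κ : Fin p → K) :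
    List (K × ((Fin p → Fin n → ℤ) → Fin n → ℤ)) :=
  List.ofFn fun i => (κ i, fun α => α i)

lemma wordDeg_freeWord {K : Type*} (n : ℕ) {p : ℕ} (κ : Fin p → K) (deg : K → ℤ) :
    wordDeg deg (freeWord n κ) = ∑ i, deg (κ i) := by
  simp [wordDeg, freeWord, List.map_ofFn, List.sum_ofFn]

variable {𝕜 G K V : Type*} [Field 𝕜] [LieRing G] [LieAlgebra 𝕜 G]
  {n : ℕ} {𝒢 : LieGrading 𝕜 G (Fin n → ℤ)} {𝒵 : LieGrading 𝕜 G ℤ}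
  {deg : K → ℤ} {g : K → (Fin n → ℤ) → G}
  [AddCommGroup V] [Module 𝕜 V] [LieRingModule 𝒵.zeroPart V] [LieModule 𝕜 𝒵.zeroPart V]

lemma IsExtragraded.span_union_eq_top (hG : IsExtragraded 𝒢 𝒵 deg g) (p : K → Prop) :
    Submodule.span 𝕜 ({x | ∃ k α, p k ∧ x = g k α} ∪ {x | ∃ k α, ¬ p k ∧ x = g k α}) = ⊤ := by
  rw [← hG.span_eq_top]
  congr 1
  ext x
  constructor
  · rintro (⟨k, α, -, rfl⟩ | ⟨k, α, -, rfl⟩) <;> exact ⟨k, α, rfl⟩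
  · rintro ⟨k, α, rfl⟩
    by_cases hk : p k
    · exact Or.inl ⟨k, α, hk, rfl⟩
    · exact Or.inr ⟨k, α, hk, rfl⟩

lemma IsExtragraded.action_mem_MTildeComp (hG : IsExtragraded 𝒢 𝒵 deg g) (k : K)
    (α : Fin n → ℤ) (i : ℤ) (m : MTilde 𝒵 V) (hm : m ∈ MTildeComp 𝒵 V i) :
    envelopingAction 𝕜 G (MTilde 𝒵 V) (g k α) m ∈ MTildeComp 𝒵 V (deg k + i) :=
  ι_smul_mem_MTildeComp 𝒵 (hG.mem_deg k α) hm

variable (𝒵 V deg g) in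
/-- The span of the `g_{k₁}(α₁) ⋯ g_{kₚ}(αₚ) v` with all `kᵢ` of negative degree and total
degree `i`. -/
noncomputable def negativeWordSpan (i : ℤ) : Submodule 𝕜 (MTilde 𝒵 V) :=
  Submodule.span 𝕜 {m | ∃ (p : ℕ) (κ : Fin p → K) (α : Fin p → Fin n → ℤ) (v : V),
    (∀ q, deg (κ q) < 0) ∧ ∑ q, deg (κ q) = i ∧
    m = wordOp (envelopingAction 𝕜 G (MTilde 𝒵 V)) g (freeWord n κ) α (toMTilde 𝒵 V v)}

lemma IsExtragraded.action_mem_negativeWordSpan {k : K} (hk : deg k < 0) (α : Fin n → ℤ) {i : ℤ}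
    {m : MTilde 𝒵 V} (hm : m ∈ negativeWordSpan V 𝒵 deg g i) :
    UniversalEnvelopingAlgebra.ι 𝕜 (g k α) • m ∈ negativeWordSpan V 𝒵 deg g (deg k + i) := by
  induction hm using Submodule.span_induction with
  | zero => simp
  | add a b _ _ ha hb => rw [smul_add]; exact add_mem ha hb
  | smul c a _ ha => rw [smul_comm]; exact Submodule.smul_mem _ c ha
  | mem m hm =>
    obtain ⟨p, κ, β, v, hκ, rfl, rfl⟩ := hm
    refine Submodule.subset_span ⟨p + 1, Fin.cons k κ, Fin.cons α β, v, fun q => ?_, ?_, ?_⟩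
    · refine Fin.cases hk (fun q => ?_) q
      exact hκ q
    · simp [Fin.sum_univ_succ]
    · rw [← envelopingAction_apply, ← Module.End.mul_apply]
      congr 1
      simp [wordOp, freeWord, List.ofFn_succ, List.map_ofFn, Function.comp_def]

/-- `M̃(V)` is spanned by the words in letters of negative degree, applied to `V`. -/
lemma IsExtragraded.iSup_negativeWordSpan (hG : IsExtragraded 𝒢 𝒵 deg g) :
    ⨆ i, negativeWordSpan V 𝒵 deg g i = ⊤ := by
  obtain ⟨N, hN, hN'⟩ : ∃ N : Submodule (UniversalEnvelopingAlgebra 𝕜 G) (MTilde 𝒵 V),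
      LinearMap.range (toMTilde 𝒵 V) ≤ N.restrictScalars 𝕜 ∧
        N.restrictScalars 𝕜 ≤ ⨆ i, negativeWordSpan V 𝒵 deg g i := by
    -- Letters of nonnegative degree preserve `V`, and those of negative degree preserve the span of
    -- negative words.
    refine exists_submodule_between (hG.span_union_eq_top fun k => deg k < 0) ?_ ?_ ?_
    · rintro _ ⟨v, rfl⟩
      exact Submodule.mem_iSup_of_mem 0 (Submodule.subset_span
        ⟨0, Fin.elim0, Fin.elim0, v, fun q => q.elim0, by simp, by simp [freeWord, wordOp]⟩)
    · rintro _ ⟨k, α, hk, rfl⟩ _ ⟨v, rfl⟩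
      rcases (not_lt.1 hk).eq_or_lt with hk | hk
      · have h := hG.mem_deg k α
        rw [← hk] at h
        exact ⟨_, (ι_smul_toMTilde_zero 𝒵 h v).symm⟩
      · rw [ι_smul_toMTilde_pos 𝒵 hk (hG.mem_deg k α)]
        exact zero_mem _
    · rintro _ ⟨k, α, hk, rfl⟩ m hm
      induction hm using Submodule.iSup_induction' with
      | zero => simp
      | add a b _ _ ha hb => rw [smul_add]; exact add_mem ha hb
      | mem i m hm => exact Submodule.mem_iSup_of_mem _ (action_mem_negativeWordSpan hk α hm)
  rw [eq_top_of_range_toMTilde_le 𝒵 hN] at hN'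
  exact eq_top_iff.2 fun m _ => hN' (Submodule.mem_top : m ∈ (⊤ : Submodule _ (MTilde 𝒵 V)))

lemma toMQuot_wordOp {X : Type*} (w : List (K × (X → Fin n → ℤ))) (x : X) (m : MTilde 𝒵 V) :
    toMQuot 𝒵 V (wordOp (envelopingAction 𝕜 G (MTilde 𝒵 V)) g w x m) =
      wordOp (envelopingAction 𝕜 G (MQuot 𝒵 V)) g w x (toMQuot 𝒵 V m) := by
  induction w with
  | nil => rfl
  | cons c t ih =>
    rw [wordOp_cons, wordOp_cons, Module.End.mul_apply, Module.End.mul_apply, ← ih]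
    rfl

variable [CharZero 𝕜]

/-- The negative words of degree `i` lie in the component of degree `i`, and over all `i` they span;
independence of the components then forces equality degree by degree. -/
lemma IsExtragraded.negativeWordSpan_eq (hG : IsExtragraded 𝒢 𝒵 deg g) (i : ℤ) :
    negativeWordSpan V 𝒵 deg g i = MTildeComp 𝒵 V i := by
  refine eq_of_le_of_iSupIndep (iSupIndep_MTildeComp 𝒵) (fun i => Submodule.span_le.2 ?_)
    hG.iSup_negativeWordSpan i
  rintro _ ⟨p, κ, α, v, -, rfl, rfl⟩
  have h := wordOp_mem (deg := deg) (fun k α i m hm => hG.action_mem_MTildeComp k α i m hm)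
    (freeWord n κ) α (toMTilde_mem_MTildeComp 𝒵 v)
  rwa [wordDeg_freeWord, add_zero] at h

lemma IsExtragraded.MTildeComp_of_pos (hG : IsExtragraded 𝒢 𝒵 deg g) {i : ℤ} (hi : 0 < i) :
    MTildeComp 𝒵 V i = ⊥ := by
  rw [← hG.negativeWordSpan_eq, eq_bot_iff, negativeWordSpan, Submodule.span_le]
  rintro _ ⟨p, κ, α, v, hκ, rfl, rfl⟩
  exact absurd hi (not_lt.2 (Finset.sum_nonpos fun q _ => (hκ q).le))

lemma IsExtragraded.MTildeComp_zero (hG : IsExtragraded 𝒢 𝒵 deg g) :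
    MTildeComp 𝒵 V 0 = LinearMap.range (toMTilde 𝒵 V) := by
  refine le_antisymm ?_ ?_
  · rw [← hG.negativeWordSpan_eq, negativeWordSpan, Submodule.span_le]
    rintro _ ⟨p, κ, α, v, hκ, h0, rfl⟩
    obtain rfl : p = 0 := by
      by_contra hp
      have : NeZero p := ⟨hp⟩
      have := Finset.sum_lt_sum_of_nonempty (Finset.univ_nonempty (α := Fin p)) fun q _ => hκ q
      simp [h0] at this
    exact ⟨v, by simp [freeWord, wordOp]⟩
  · rintro _ ⟨v, rfl⟩
    exact toMTilde_mem_MTildeComp 𝒵 v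

lemma IsExtragraded.disjoint_range_toMTilde (hG : IsExtragraded 𝒢 𝒵 deg g) :
    Disjoint (⨆ i : {i : ℤ // i < 0}, MTildeComp 𝒵 V i) (LinearMap.range (toMTilde 𝒵 V)) := by
  rw [← hG.MTildeComp_zero]
  refine ((iSupIndep_MTildeComp 𝒵 (V := V)) 0).symm.mono_left (iSup_le fun i => ?_)
  exact le_iSup₂_of_le (i : ℤ) i.2.ne le_rfl

/-- The radical has no components of nonnegative degree. -/
lemma IsExtragraded.MTildeRad_le_iSup (hG : IsExtragraded 𝒢 𝒵 deg g) :
    (MTildeRad 𝒵 V).restrictScalars 𝕜 ≤ ⨆ i : {i : ℤ // i < 0}, MTildeComp 𝒵 V i := by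
  intro m hm
  have hm' : m ∈ MTildeRad 𝒵 V := hm
  rw [MTildeRad, sSup_eq_iSup'] at hm'
  refine Submodule.iSup_induction (motive := fun m => m ∈ ⨆ i : {i : ℤ // i < 0},
    MTildeComp 𝒵 V i) _ hm' ?_ (zero_mem _) fun _ _ => add_mem
  rintro ⟨N, hN, hNV⟩ a ha
  have ha' : a ∈ N.restrictScalars 𝕜 := ha
  rw [hN] at ha'
  refine (iSup_le fun i => ?_ : (⨆ i : ℤ, N.restrictScalars 𝕜 ⊓ MTildeComp 𝒵 V i) ≤ _) ha'
  rcases lt_trichotomy i 0 with hi | rfl | hi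
  · exact inf_le_right.trans
      (le_iSup (fun i : {i : ℤ // i < 0} => MTildeComp 𝒵 V i) ⟨i, hi⟩)
  -- The degree-zero part of `N` is its intersection with `V`.
  · rw [hG.MTildeComp_zero, hNV]
    exact bot_le
  · rw [hG.MTildeComp_of_pos hi, inf_bot_eq]
    exact bot_le

/-- A vector of negative degree which is mapped into the radical by the operators of positive
degree belongs to the radical. -/
lemma IsExtragraded.mem_MTildeRad (hG : IsExtragraded 𝒢 𝒵 deg g) {i : ℤ} (hi : i < 0)
    {m : MTilde 𝒵 V} (hm : m ∈ MTildeComp 𝒵 V i)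
    (h : ∀ k α, 0 < deg k → deg k ≤ -i →
      UniversalEnvelopingAlgebra.ι 𝕜 (g k α) • m ∈ MTildeRad 𝒵 V) : m ∈ MTildeRad 𝒵 V := by
  obtain ⟨N, hN, hN'⟩ : ∃ N : Submodule (UniversalEnvelopingAlgebra 𝕜 G) (MTilde 𝒵 V),
      (MTildeRad 𝒵 V).restrictScalars 𝕜 ⊔ Submodule.span 𝕜 {m} ≤ N.restrictScalars 𝕜 ∧
        N.restrictScalars 𝕜 ≤ ⨆ i : {i : ℤ // i < 0}, MTildeComp 𝒵 V i := by
    -- Positive letters preserve the radical plus the line of `m`, and nonpositive letters preserve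
    -- the negative part. So the submodule generated by `m` stays in negative degrees and misses
    -- `V`.
    refine exists_submodule_between (hG.span_union_eq_top fun k => deg k ≤ 0) ?_ ?_ ?_
    · refine sup_le hG.MTildeRad_le_iSup ((Submodule.span_singleton_le_iff_mem _ _).2 ?_)
      exact Submodule.mem_iSup_of_mem (p := fun i : {i : ℤ // i < 0} => MTildeComp 𝒵 V i)
        ⟨i, hi⟩ hm
    · rintro _ ⟨k, α, hk, rfl⟩ a ha
      obtain ⟨b, hb, c, hc, rfl⟩ := Submodule.mem_sup.1 ha
      obtain ⟨t, rfl⟩ := Submodule.mem_span_singleton.1 hc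
      refine Submodule.mem_sup_left ?_
      rw [smul_add, smul_comm]
      refine add_mem ((MTildeRad 𝒵 V).smul_mem _ hb) (Submodule.smul_mem _ t ?_)
      -- A letter of degree greater than `-i` sends `m` to positive degree, where `M̃(V)` vanishes.
      by_cases hki : deg k ≤ -i
      · exact h k α (not_le.1 hk) hki
      · have h₀ := hG.action_mem_MTildeComp k α i m hm
        rw [hG.MTildeComp_of_pos (by omega), Submodule.mem_bot, envelopingAction_apply] at h₀
        rw [h₀]
        exact zero_mem _
    · rintro _ ⟨k, α, hk, rfl⟩ a ha
      induction ha using Submodule.iSup_induction' with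
      | zero => simp
      | add a b _ _ ha hb => rw [smul_add]; exact add_mem ha hb
      | mem j a ha =>
        exact Submodule.mem_iSup_of_mem (p := fun i : {i : ℤ // i < 0} => MTildeComp 𝒵 V i)
          ⟨deg k + j, by have := j.2; omega⟩ (hG.action_mem_MTildeComp k α j a ha)
  have hmN : m ∈ N :=
    hN (Submodule.mem_sup_right (Submodule.mem_span_singleton_self m))
  have hle : (Submodule.span (UniversalEnvelopingAlgebra 𝕜 G) {m}).restrictScalars 𝕜 ≤
      ⨆ i : {i : ℤ // i < 0}, MTildeComp 𝒵 V i := fun a ha =>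
    hN' ((Submodule.span_singleton_le_iff_mem m N).2 hmN ha)
  have hrad : Submodule.span (UniversalEnvelopingAlgebra 𝕜 G) {m} ≤ MTildeRad 𝒵 V :=
    le_sSup ⟨isGradedSubmodule_span_singleton 𝒵 hm,
      (hG.disjoint_range_toMTilde.mono_left hle).eq_bot⟩
  exact hrad (Submodule.mem_span_singleton_self m)

/-- All words in the `g_k(α)`, applied to the image of a basis of `V`, give functions of finite
rank with values in `M(V)`. -/
lemma IsExtragraded.word_mem_coeffFunctions_MQuot (hG : IsExtragraded 𝒢 𝒵 deg g) {d : ℕ}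
    {v : Fin d → V}
    {h : {k : K // deg k = 0} → Fin d → Fin d → expPolynomial 𝕜 (Fin n)}
    (hv : ∀ k α j, ⁅hG.zeroFamily k α, v j⁆ = ∑ s, (h k j s : (Fin n → ℤ) → 𝕜) α • v s)
    {X : Type} (E : Subalgebra 𝕜 (X → 𝕜)) (w : List (K × (X → Fin n → ℤ)))
    (hadm : ∀ c ∈ w, IsAdmissible E c.2) (j : Fin d) :
    (fun x => wordOp (envelopingAction 𝕜 G (MQuot 𝒵 V)) g w x (toMQuot 𝒵 V (toMTilde 𝒵 V (v j)))) ∈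
      coeffFunctions E (MQuot 𝒵 V) := by
  obtain ⟨f, hf, hbr⟩ := hG.exists_homogeneous_bracket
  refine word_mem_coeffFunctions (deg := deg) (ℳ := MQuotComp 𝒵 V)
    (v := fun j => toMQuot 𝒵 V (toMTilde 𝒵 V (v j))) hf hbr hG.finite_deg ?_ ?_ ?_ ?_ ?_ E w hadm j
  · intro k α j hk
    rw [envelopingAction_apply, ← toMQuot_smul, ι_smul_toMTilde_pos 𝒵 hk (hG.mem_deg k α), map_zero]
  · intro k hk
    refine ⟨h ⟨k, hk⟩, fun α j => ?_⟩
    have h₀ := hG.mem_deg k α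
    rw [hk] at h₀
    have h₁ : ⁅(⟨g k α, h₀⟩ : 𝒵.zeroPart), v j⁆ =
        ∑ s, (h ⟨k, hk⟩ j s : (Fin n → ℤ) → 𝕜) α • v s := hv ⟨k, hk⟩ α j
    rw [envelopingAction_apply, ← toMQuot_smul, ι_smul_toMTilde_zero 𝒵 h₀, h₁, map_sum, map_sum]
    simp only [map_smul]
  · exact fun j => ⟨_, toMTilde_mem_MTildeComp 𝒵 (v j), rfl⟩
  · rintro k α i _ ⟨m, hm, rfl⟩
    exact ⟨_, hG.action_mem_MTildeComp k α i m hm, rfl⟩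
  · rintro i hi _ ⟨m, hm, rfl⟩ h₀
    refine (toMQuot_eq_zero 𝒵).2 (hG.mem_MTildeRad hi hm fun k α hk hk' => ?_)
    exact (toMQuot_eq_zero 𝒵).1 (h₀ k α hk hk')

/-- The homogeneous components of `M(V)` are finite-dimensional. -/
theorem IsExtragraded.finiteDimensional_MQuotComp (hG : IsExtragraded 𝒢 𝒵 deg g)
    (hV : IsFiniteExpPolynomialModule 𝕜 V hG.zeroFamily) (i : ℤ) :
    FiniteDimensional 𝕜 (MQuotComp 𝒵 V i) := by
  obtain ⟨d, v, h, hv⟩ := hV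
  let L : Set K := {k | i ≤ deg k ∧ deg k < 0}
  have hL : L.Finite := by
    refine ((Set.finite_Icc i 0).biUnion fun j _ => hG.finite_deg j).subset fun k hk => ?_
    exact Set.mem_biUnion (show deg k ∈ Set.Icc i 0 from ⟨hk.1, hk.2.le⟩) rfl
  have : Finite L := hL
  have hW : ∀ t : (Σ p : Fin (i.natAbs + 1), Fin p → L) × Fin d,
      ∃ W : Submodule 𝕜 (MQuot 𝒵 V), FiniteDimensional 𝕜 W ∧ ∀ α,
        wordOp (envelopingAction 𝕜 G (MQuot 𝒵 V)) g (freeWord n fun q => (t.1.2 q : K)) α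
          (toMQuot 𝒵 V (toMTilde 𝒵 V (v t.2))) ∈ W := fun t =>
    -- Only finite rank matters now, so `E` may be the algebra of all functions and admissibility is
    -- free.
    exists_finiteDimensional_of_mem_coeffFunctions
      (hG.word_mem_coeffFunctions_MQuot hv ⊤ _ (fun c _ j => ⟨trivial, fun _ _ => trivial⟩) t.2)
  choose W hWfin hW using hW
  have hle : MQuotComp 𝒵 V i ≤ ⨆ t, W t := by
    rw [MQuotComp_eq_map, ← hG.negativeWordSpan_eq, negativeWordSpan, Submodule.map_span_le]
    rintro _ ⟨p, κ, α, u, hκ, hi, rfl⟩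
    -- Every letter has degree at most `-1` and the total is `i`, so the length is at most `|i|`;
    -- likewise no letter can have degree below `i`.
    have hp : p < i.natAbs + 1 := by
      have := Finset.sum_le_card_nsmul Finset.univ (fun q => deg (κ q)) (-1)
        fun q _ => by have := hκ q; omega
      simp [hi] at this
      omega
    have hκL : ∀ q, κ q ∈ L := fun q => by
      refine ⟨?_, hκ q⟩
      rw [← hi, ← Finset.add_sum_erase _ _ (Finset.mem_univ q)]
      have := Finset.sum_nonpos fun r (_ : r ∈ Finset.univ.erase q) => (hκ r).le
      omega
    rw [toMQuot_wordOp, ← v.sum_repr u, map_sum, map_sum, map_sum]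
    refine Submodule.sum_mem _ fun j _ => ?_
    rw [map_smul, map_smul, map_smul]
    refine Submodule.smul_mem _ _ (Submodule.mem_iSup_of_mem
      ((⟨⟨p, hp⟩, fun q => ⟨κ q, hκL q⟩⟩, j) : (Σ p : Fin (i.natAbs + 1), Fin p → L) × Fin d) ?_)
    exact hW (⟨⟨p, hp⟩, fun q => ⟨κ q, hκL q⟩⟩, j) α
  exact Submodule.finiteDimensional_of_le hle

end Finiteness

theorem theorem1p7 {𝕜 G K V : Type*} [Field 𝕜] [CharZero 𝕜] [LieRing G] [LieAlgebra 𝕜 G]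
    {n : ℕ} (𝒢 : LieGrading 𝕜 G (Fin n → ℤ)) (𝒵 : LieGrading 𝕜 G ℤ)
    (deg : K → ℤ) (g : K → (Fin n → ℤ) → G) (hG : IsExtragraded 𝒢 𝒵 deg g)
    [AddCommGroup V] [Module 𝕜 V] [LieRingModule 𝒵.zeroPart V] [LieModule 𝕜 𝒵.zeroPart V]
    (hV : IsFiniteExpPolynomialModule 𝕜 V hG.zeroFamily) :
    IsModuleGrading 𝒵 (MQuotComp 𝒵 V) ∧
      ∀ i : ℤ, FiniteDimensional 𝕜 (MQuotComp 𝒵 V i) :=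
  ⟨isModuleGrading_MQuotComp 𝒵, hG.finiteDimensional_MQuotComp hV⟩
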